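/- Let $d$ be a positive integer. Let $\mathcal L=\mathrm{SL}(d,\mathbb R)/\mathrm{SL}(d,\mathbb Z)$ be the space of unimodular lattices in $\mathbb R^d$ (the coset of $g$ being identified with the lattice $g\mathbb Z^d$), and let $\mu$ be the Haar probability measure on $\mathcal L$, i.e. the $\mathrm{SL}(d,\mathbb R)$-invariant Borel probability measure, induced by the Haar measure of $\mathrm{SL}(d,\mathbb R)$. For a lattice $\Lambda\subset\mathbb R^d$ and $1\le i\le d$ let $\lambda_i(\Lambda)$ be the $i$-th successive minimum, i.e. the infimum of all $r$ such that $\{v\in\Lambda:\|v\|\le r\}$ contains $i$ linearly independent vectors, where $\|\cdot\|$ is the Euclidean norm. Put $$\Phi_i(\delta):=\mu(\{\Lambda\in\mathcal L:\lambda_i(\Lambda)\le\delta\}).$$ Then there are constants $C_d>0$ and $C_d'>0$, depending only on $d$, such that for every integer $i$ with $1\le i<d$ and all sufficiently small $\delta>0$, $$C_d\,\delta^{di}-o(\delta^{di})\ \le\ \Phi_i(\delta)\ \le\ C_d'\,\delta^{di}\qquad(\delta\to0^+).$$ -/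

import Mathlib

open Matrix MeasureTheory Topology Set Asymptotics

/-- `SL(d, ℝ)`, with the topology induced from the space of `d × d` matrices. -/
abbrev SLR (d : ℕ) : Type := SpecialLinearGroup (Fin d) ℝ

/-- `SL(d, ℤ)`, as a subgroup of `SL(d, ℝ)`. -/
abbrev SLZ (d : ℕ) : Subgroup (SLR d) :=
  (SpecialLinearGroup.map (n := Fin d) (Int.castRingHom ℝ)).range

/-- The Borel `σ`-algebra of `SL(d, ℝ)`. -/
instance SLR.instMeasurableSpace (d : ℕ) : MeasurableSpace (SLR d) := borel _

instance SLR.instBorelSpace (d : ℕ) : BorelSpace (SLR d) := ⟨rfl⟩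

instance SLR.instLocallyCompactSpace (d : ℕ) : LocallyCompactSpace (SLR d) :=
  haveI : LocallyCompactSpace (Matrix (Fin d) (Fin d) ℝ) :=
    inferInstanceAs (LocallyCompactSpace (Fin d → Fin d → ℝ))
  SpecialLinearGroup.isClosedEmbedding_val.locallyCompactSpace

instance SLR.instSecondCountableTopology (d : ℕ) : SecondCountableTopology (SLR d) :=
  haveI : SecondCountableTopology (Matrix (Fin d) (Fin d) ℝ) :=
    inferInstanceAs (SecondCountableTopology (Fin d → Fin d → ℝ))
  SpecialLinearGroup.isClosedEmbedding_val.isEmbedding.secondCountableTopology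

/-- The lattice `g ℤ^d`, spanned over `ℤ` by the columns of `g`, in Euclidean space `ℝ^d`. -/
def columnLattice {d : ℕ} (g : SLR d) : Submodule ℤ (EuclideanSpace ℝ (Fin d)) :=
  Submodule.span ℤ (range fun j : Fin d => WithLp.toLp 2 fun i : Fin d => g i j)

theorem columnLattice_mul_le {d : ℕ} (g : SLR d) {γ : SLR d} (hγ : γ ∈ SLZ d) :
    columnLattice (g * γ) ≤ columnLattice g := by
  obtain ⟨m, rfl⟩ := hγ
  refine Submodule.span_le.2 ?_
  rintro _ ⟨j, rfl⟩
  have h : (WithLp.toLp 2 fun i : Fin d =>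
      (g * SpecialLinearGroup.map (n := Fin d) (Int.castRingHom ℝ) m) i j) =
      ∑ k, m k j • (WithLp.toLp 2 fun i : Fin d => g i k : EuclideanSpace ℝ (Fin d)) := by
    ext i
    simp [Matrix.mul_apply, mul_comm]
  rw [SetLike.mem_coe]
  simp only [h]
  exact Submodule.sum_mem _ fun k _ =>
    Submodule.smul_mem _ _ (Submodule.subset_span ⟨k, rfl⟩)

theorem columnLattice_mul {d : ℕ} (g : SLR d) {γ : SLR d} (hγ : γ ∈ SLZ d) :
    columnLattice (g * γ) = columnLattice g := by
  refine le_antisymm (columnLattice_mul_le g hγ) ?_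
  simpa using columnLattice_mul_le (g * γ) (inv_mem hγ)

/-- The space of unimodular lattices in `ℝ^d`, as the homogeneous space
`SL(d, ℝ) / SL(d, ℤ)`: the coset of `g` is the lattice `g ℤ^d`. It carries the quotient
`σ`-algebra (a set is measurable when its preimage in `SL(d, ℝ)` is Borel). -/
abbrev UnimodularLattices (d : ℕ) : Type := SLR d ⧸ SLZ d

/-- The unimodular lattice `g ℤ^d ⊆ ℝ^d` that belongs to the coset `g SL(d, ℤ)`. -/
def UnimodularLattices.lattice {d : ℕ} (x : UnimodularLattices d) :
    Submodule ℤ (EuclideanSpace ℝ (Fin d)) :=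
  Quotient.liftOn' x columnLattice fun a b hab => by
    have h := columnLattice_mul a (QuotientGroup.leftRel_apply.1 hab)
    rw [← h, mul_inv_cancel_left]

/-- The `j`-th successive minimum of a lattice: the infimum of the `r` such that the closed
Euclidean ball of radius `r` about `0` contains `j` linearly independent lattice vectors. -/
noncomputable def successiveMinimum {d : ℕ} (j : ℕ)
    (L : Submodule ℤ (EuclideanSpace ℝ (Fin d))) : ℝ :=
  sInf {r : ℝ | ∃ v : Fin j → EuclideanSpace ℝ (Fin d),
    LinearIndependent ℝ v ∧ ∀ k, v k ∈ L ∧ ‖v k‖ ≤ r}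

/-- A discrete subgroup of a second countable group has a Borel fundamental domain for its action
by right multiplication, in the strict sense: one point in every orbit. -/
theorem exists_strict_fundamentalDomain {G : Type*} [Group G] [TopologicalSpace G]
    [IsTopologicalGroup G] [SecondCountableTopology G] [MeasurableSpace G] [BorelSpace G]
    (Γ : Subgroup G) [DiscreteTopology Γ] :
    ∃ F : Set G, MeasurableSet F ∧ ∀ g : G, ∃! γ : Γ, g * γ ∈ F := by
  obtain ⟨V, hV, hVΓ⟩ : ∃ V ∈ 𝓝 (1 : G), ∀ γ : Γ, (γ : G) ∈ V → γ = 1 := by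
    have h : ({1} : Set Γ) ∈ 𝓝 (1 : Γ) := by simp
    rw [nhds_subtype_eq_comap, Filter.mem_comap] at h
    obtain ⟨V, hV, h⟩ := h
    exact ⟨V, hV, fun γ hγ => by simpa using h hγ⟩
  obtain ⟨U, hUo, hU1, hUV⟩ : ∃ U : Set G, IsOpen U ∧ (1 : G) ∈ U ∧
      ∀ x ∈ U, ∀ y ∈ U, x⁻¹ * y ∈ V := by
    have hc : Filter.Tendsto (fun p : G × G => p.1⁻¹ * p.2) (𝓝 (1, 1)) (𝓝 1) := by
      have : Continuous fun p : G × G => p.1⁻¹ * p.2 := by fun_prop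
      simpa using this.tendsto (1, 1)
    have h := hc hV
    rw [Filter.mem_map, nhds_prod_eq, Filter.mem_prod_same_iff] at h
    obtain ⟨t, ht, h⟩ := h
    obtain ⟨U, hUt, hUo, hU1⟩ := mem_nhds_iff.1 ht
    exact ⟨U, hUo, hU1, fun x hx y hy => h (mk_mem_prod (hUt hx) (hUt hy))⟩
  obtain ⟨f, hf⟩ : ∃ f : ℕ → G, ∀ g, ∃ n, (f n)⁻¹ * g ∈ U := by
    have hn : ∀ x : G, (fun g => x⁻¹ * g) ⁻¹' U ∈ 𝓝 x := fun x =>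
      (hUo.preimage (by fun_prop)).mem_nhds (by simpa using hU1)
    obtain ⟨s, hs, hsU⟩ := TopologicalSpace.countable_cover_nhds hn
    have hne : s.Nonempty := by
      by_contra h
      rw [not_nonempty_iff_eq_empty] at h
      simp [h] at hsU
      exact (hsU.symm ▸ mem_univ (1 : G) : (1 : G) ∈ (∅ : Set G))
    obtain ⟨f, rfl⟩ := hs.exists_eq_range hne
    refine ⟨f, fun g => ?_⟩
    have hg : g ∈ ⋃ x ∈ range f, (fun g => x⁻¹ * g) ⁻¹' U := hsU ▸ mem_univ g
    simpa using hg
  refine ⟨⋃ n, ({g | (f n)⁻¹ * g ∈ U} ∩ ⋂ m : {m // m < n}, ⋂ γ : Γ,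
    {g | (f m)⁻¹ * (g * γ) ∈ U}ᶜ), ?_, fun g => ?_⟩
  · refine MeasurableSet.iUnion fun n => MeasurableSet.inter ?_ ?_
    · exact (hUo.preimage (f := fun g => (f n)⁻¹ * g) (by fun_prop)).measurableSet
    · refine (isClosed_iInter fun m => isClosed_iInter fun γ => ?_).measurableSet
      exact (hUo.preimage (f := fun g => (f m)⁻¹ * (g * γ)) (by fun_prop)).isClosed_compl
  · classical
    have hex : ∃ n, ∃ γ : Γ, (f n)⁻¹ * (g * γ) ∈ U := by
      obtain ⟨n, hn⟩ := hf g
      exact ⟨n, 1, by simpa using hn⟩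
    obtain ⟨γ, hγ⟩ := Nat.find_spec hex
    have key : ∀ η : Γ, g * η ∈ (⋃ n, ({g | (f n)⁻¹ * g ∈ U} ∩ ⋂ m : {m // m < n}, ⋂ γ : Γ,
        {g | (f m)⁻¹ * (g * γ) ∈ U}ᶜ)) ↔ (f (Nat.find hex))⁻¹ * (g * η) ∈ U := by
      intro η
      simp only [mem_iUnion, mem_inter_iff, mem_iInter, mem_ofPred_eq, mem_compl_iff,
        Subtype.forall]
      constructor
      · rintro ⟨n, h1, h2⟩
        have hle : Nat.find hex ≤ n := Nat.find_le ⟨η, h1⟩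
        rcases hle.lt_or_eq with hlt | heq
        · exact absurd (by simpa [mul_assoc] using hγ)
            (h2 _ hlt (η⁻¹ * γ : G) (Γ.mul_mem (Γ.inv_mem η.2) γ.2))
        · rwa [heq]
      · intro h
        refine ⟨_, h, fun m hm η' hη' hmem => Nat.find_min hex hm ⟨η * ⟨η', hη'⟩, ?_⟩⟩
        simpa [mul_assoc] using hmem
    refine ⟨γ, (key γ).2 hγ, fun η hη => ?_⟩
    have h := hUV _ hγ _ ((key η).1 hη)
    have h1 : γ⁻¹ * η = 1 := hVΓ _ (by simpa [mul_assoc] using h)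
    exact (inv_mul_eq_one.1 h1).symm

/-- A Borel fundamental domain for the action of `SL(d, ℤ)` on `SL(d, ℝ)` by right
multiplication. -/
noncomputable def fundamentalDomainSLZ (d : ℕ) : Set (SLR d) :=
  (exists_strict_fundamentalDomain (SLZ d)).choose

theorem fundamentalDomainSLZ_spec (d : ℕ) :
    MeasurableSet (fundamentalDomainSLZ d) ∧ ∀ g : SLR d, ∃! γ : SLZ d, g * γ ∈ fundamentalDomainSLZ d :=
  (exists_strict_fundamentalDomain (SLZ d)).choose_spec

/-- The Haar probability measure on the space `SL(d, ℝ) / SL(d, ℤ)` of unimodular lattices: the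
image of a Haar measure of `SL(d, ℝ)`, restricted to a fundamental domain of `SL(d, ℤ)` and
normalized to total mass `1`. As `SL(d, ℝ)` is unimodular and `SL(d, ℤ)` has finite covolume,
it is the unique `SL(d, ℝ)`-invariant Borel probability measure, whatever the fundamental
domain. -/
noncomputable def haarProbability (d : ℕ) : Measure (UnimodularLattices d) :=
  (ProbabilityTheory.cond Measure.haar (fundamentalDomainSLZ d)).map
    (QuotientGroup.mk : SLR d → UnimodularLattices d)

/-- `Φ_i(δ)`: the Haar probability that the `i`-th successive minimum is at most `δ`. -/
noncomputable def minimaDistribution (d i : ℕ) (δ : ℝ) : ℝ :=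
  (haarProbability d).real {x | successiveMinimum i x.lattice ≤ δ}

/-!
Identify a lattice with a basis, the rows of a matrix `A` with determinant in `(0, 1]`; a change of
basis is the left multiplication by an element of `SL(d, ℤ)`, and it preserves Lebesgue measure. The
cone over a subset of `SL(d, ℝ)`, cut off at determinant `1`, has a Lebesgue measure which is
invariant under `SL(d, ℝ)`, so that Haar measure can be replaced by Lebesgue measure on
`{A | 0 < det A ≤ 1}` (`minimaDistribution_eq`). Volumes within a fundamental domain are then
estimated by comparison with explicit sets (`IsLatticeFundamentalDomain.volume_inter_le` and
`IsLatticeFundamentalDomain.le_volume_inter`): a set that meets all orbits in question bounds the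
volume from above, a set that meets no orbit twice bounds it from below.

The explicit sets come from a splitting of `A` into its first `i` rows `B` and the rest. If the left
`i × i` minor of `B` does not vanish, then `A = [1, 0; Y, N] * k(B)`, where `k(B)` has determinant
`1` and `B` as its first rows. In the coordinates `(B, Y, N)` Lebesgue measure is a product measure
and `det A = det N`. With `Y` restricted to the unit cube, which is possible as the lattice spanned by
`B` may be used to change the other rows, the volume is that of the set of the `B` times that of the
set of the `N` (`volume_framedSet`).

For the upper bound, a lattice with `λ_i ≤ δ` has a basis whose first `i` vectors are `O(δ)`
(`exists_specialLinearGroup_rows_le`), and `N` can be reduced to a set that covers all lattices in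
dimension `d - i`. So the volume is `O(δ ^ (d * i))`, provided that this covering set can be chosen
with finite volume. For `i = 1` and the bound of Minkowski's theorem in place of `δ`, the same
argument proves this finiteness by induction on the dimension
(`exists_coversLattices_volume_lt_top`).

For the lower bound, let `B / δ` range over a small neighbourhood of `[1, 0]`, and `N` over one of a
scalar matrix. All vectors of length `O(δ)` of the lattice lie in the span of `B`; hence two such
matrices with the same lattice are equal (`eq_one_of_mul_mem_framedSet`), and the volume of the set is
exactly a constant times `δ ^ (d * i)`. The error term `ε` can thus be taken to be zero.
-/

/-! ### Lattice bases with short vectors -/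

/-- The Euclidean algorithm for the coordinates `a` of a vector: changing only the basis vectors with
index in `s`, one makes all coordinates with index in `s` vanish but the one at `p`, and the latter
dominates the remaining coordinates. Here `b` is the new coordinate vector and `δ` the change of
basis. -/
theorem exists_integral_row_reduction {κ : Type*} [Fintype κ] [DecidableEq κ] (s : Set κ) {p : κ}
    (hp : p ∈ s) (a : κ → ℤ) (ha : ∃ j ∈ s, a j ≠ 0) :
    ∃ (δ : Matrix κ κ ℤ) (b : κ → ℤ), δ.det = 1 ∧ b ᵥ* δ = a ∧
      (∀ k ∉ s, δ k = Pi.single k 1) ∧ (∀ j ∈ s, j ≠ p → b j = 0) ∧ b p ≠ 0 ∧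
      ∀ k ∉ s, |b k| ≤ |b p| := by
  classical
  set R : Set (κ → ℤ) := {b | ∃ δ : Matrix κ κ ℤ, δ.det = 1 ∧ b ᵥ* δ = a ∧
    ∀ k ∉ s, δ k = Pi.single k 1} with hR
  have hstep : ∀ b ∈ R, ∀ j ∈ s, ∀ c : κ → ℤ, c j = 0 → b - b j • c ∈ R := by
    rintro b ⟨δ, hδ1, hδ, hrow⟩ j hj c hc
    have hdet : (1 + vecMulVec (Pi.single j 1) c : Matrix κ κ ℤ).det = 1 := by
      rw [vecMulVec_eq Unit, det_one_add_replicateCol_mul_replicateRow]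
      simp [hc]
    refine ⟨(1 + vecMulVec (Pi.single j 1) c) * δ, by rw [det_mul, hdet, hδ1, one_mul], ?_,
      fun k hk => ?_⟩
    · rw [← vecMul_vecMul, ← hδ]
      congr 1
      simp only [vecMul_add, vecMul_one, vecMul_vecMulVec]
      ext k
      simp [hc]
    · have hkj : k ≠ j := fun h => hk (h ▸ hj)
      rw [← hrow k hk]
      ext l
      rw [Matrix.add_mul, Matrix.one_mul]
      simp [Matrix.mul_apply, vecMulVec_apply, hkj]
  have haR : a ∈ R := ⟨1, det_one, by simp, fun k _ => by
    ext l
    simp [Matrix.one_apply, Pi.single_apply, eq_comm]⟩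
  -- The smallest nonzero absolute value that occurs at a position in `s`.
  have hex : ∃ n : ℕ, ∃ b ∈ R, ∃ j ∈ s, b j ≠ 0 ∧ (b j).natAbs = n := by
    obtain ⟨j, hj, h⟩ := ha
    exact ⟨_, a, haR, j, hj, h, rfl⟩
  obtain ⟨b, hb, j, hj, hbj, hn⟩ := Nat.find_spec hex
  have hmin : ∀ b' ∈ R, ∀ k ∈ s, |b' k| < |b j| → b' k = 0 := by
    intro b' hb' k hk hlt
    by_contra h
    refine Nat.find_min hex (m := (b' k).natAbs) ?_ ⟨b', hb', k, hk, h, rfl⟩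
    rw [← hn]
    zify
    exact hlt
  -- Reduce all other coordinates modulo the smallest one.
  set b' : κ → ℤ := b - b j • fun k => if k = j then 0 else b k / b j with hb'
  have hb'R : b' ∈ R := hstep b hb j hj _ (by simp)
  have hb'j : b' j = b j := by simp [hb']
  have hlt : ∀ k, k ≠ j → |b' k| < |b j| := by
    intro k hk
    have : b' k = b k % b j := by
      simp only [hb', Pi.sub_apply, Pi.smul_apply, hk, if_false, smul_eq_mul]
      rw [Int.emod_def]
    rw [this, abs_of_nonneg (Int.emod_nonneg _ hbj)]
    exact Int.emod_lt_abs _ hbj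
  by_cases hjp : j = p
  · subst hjp
    obtain ⟨δ, h0, h1, h2⟩ := hb'R
    refine ⟨δ, b', h0, h1, h2, fun k hk hkj => hmin b' ⟨δ, h0, h1, h2⟩ k hk (hlt k hkj),
      by rwa [hb'j], fun k hk => ?_⟩
    rw [hb'j]
    exact (hlt k fun h => hk (h ▸ hj)).le
  · have hpj : p ≠ j := fun h => hjp h.symm
    -- Move the only surviving coordinate on `s` from `j` to `p`.
    have hb'p : b' p = 0 := hmin b' hb'R p hp (hlt p hpj)
    have h1 := hstep b' hb'R j hj (Pi.single p (-1)) (by simp [hjp])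
    have h2 := hstep _ h1 p hp (Pi.single j 1) (by simp [hpj])
    generalize hb'' : b' - b' j • Pi.single p (-1) -
      (b' - b' j • Pi.single p (-1) : κ → ℤ) p • Pi.single j 1 = b'' at h2
    have e : ∀ k, b'' k = if k = j then 0 else if k = p then b j else b' k := by
      intro k
      by_cases hk : k = j
      · subst hk; simp [← hb'', hjp, hb'p]
      · by_cases hk' : k = p
        · subst hk'; simp [← hb'', hk, hb'p, hb'j]
        · simp [← hb'', hk, hk']
    obtain ⟨δ, h0, h3, h4⟩ := h2
    refine ⟨δ, b'', h0, h3, h4, fun k hk hkp => ?_, by simpa [e, hpj] using hbj, fun k hk => ?_⟩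
    · rw [e]
      split_ifs with hkj
      · rfl
      · exact hmin b' hb'R k hk (hlt k hkj)
    · have hkj : k ≠ j := fun h => hk (h ▸ hj)
      have hkp : k ≠ p := fun h => hk (h ▸ hp)
      rw [e, e, if_neg hkj, if_neg hkp, if_neg hpj, if_pos rfl]
      exact (hlt k hkj).le

/-- Independent lattice vectors `z 0, z 1, …` of size at most `r` can be traded for the members of a
basis of the whole lattice with prescribed indices `f 0, f 1, …`, at the cost of a factor `2 ^ k`. The
membership in the span serves the induction. -/
theorem exists_specialLinearGroup_rows_le {κ : Type*} [Fintype κ] [DecidableEq κ]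
    (N : Seminorm ℝ (κ → ℝ)) (r : ℝ) (i : ℕ) (z : Fin i → κ → ℤ)
    (hz : LinearIndependent ℝ fun k l => (z k l : ℝ)) (hN : ∀ k, N (fun l => (z k l : ℝ)) ≤ r)
    (f : Fin i → κ) (hf : Function.Injective f) :
    ∃ γ : Matrix κ κ ℤ, γ.det = 1 ∧ ∀ k, N (fun l => (γ (f k) l : ℝ)) ≤ 2 ^ (k : ℕ) * r ∧
      (fun l => (γ (f k) l : ℝ)) ∈ Submodule.span ℝ (range fun k l => (z k l : ℝ)) := by
  induction i with
  | zero => exact ⟨1, det_one, fun k => k.elim0⟩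
  | succ i ih =>
    obtain ⟨γ, hγ1, hγ⟩ := ih (fun k => z k.castSucc) (hz.comp _ (Fin.castSucc_injective i))
      (fun k => hN _) (fun k => f k.castSucc) (hf.comp (Fin.castSucc_injective i))
    set s : Set κ := (range fun k : Fin i => f k.castSucc)ᶜ with hs
    set p := f (Fin.last i) with hp
    have hps : p ∈ s := by
      rintro ⟨k, hk⟩
      exact (Fin.castSucc_lt_last k).ne (hf hk)
    set a : κ → ℤ := z (Fin.last i) ᵥ* γ⁻¹ with ha
    have haz : a ᵥ* γ = z (Fin.last i) := by
      rw [ha, vecMul_vecMul, nonsing_inv_mul _ (by simp [hγ1]), vecMul_one]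
    have hmono : Submodule.span ℝ (range fun (k : Fin i) l => (z k.castSucc l : ℝ)) ≤
        Submodule.span ℝ (range fun k l => (z k l : ℝ)) := by
      refine Submodule.span_mono ?_
      rintro _ ⟨k, rfl⟩
      exact ⟨k.castSucc, rfl⟩
    have hane : ∃ j ∈ s, a j ≠ 0 := by
      by_contra! h
      have hmem : (fun l => (z (Fin.last i) l : ℝ)) ∈
          Submodule.span ℝ (range fun (k : Fin i) l => (z k.castSucc l : ℝ)) := by
        have : (fun l => (z (Fin.last i) l : ℝ)) = ∑ j, (a j : ℝ) • fun l => (γ j l : ℝ) := by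
          ext l
          rw [← haz]
          simp [vecMul, dotProduct]
        rw [this]
        refine Submodule.sum_mem _ fun j _ => ?_
        by_cases hj : j ∈ s
        · simp [h j hj]
        · obtain ⟨k, rfl⟩ := not_not.1 hj
          exact Submodule.smul_mem _ _ (hγ k).2
      have := linearIndependent_finSucc'.1 hz
      exact this.2 hmem
    obtain ⟨δ, b, hδ1, hba, hrow, hzero, hbp, hle⟩ := exists_integral_row_reduction s hps a hane
    have hrow' : ∀ k ∉ s, (δ * γ) k = γ k := by
      intro k hk
      ext l
      rw [Matrix.mul_apply]
      simp [hrow k hk, Pi.single_apply]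
    have hbp' : (b p : ℝ) ≠ 0 := by exact_mod_cast hbp
    -- The new row is determined by the expansion of the last vector in the new basis.
    have hnew : (fun l => ((δ * γ) p l : ℝ)) = (b p : ℝ)⁻¹ • ((fun l => (z (Fin.last i) l : ℝ)) -
        ∑ k : Fin i, (b (f k.castSucc) : ℝ) • fun l => (γ (f k.castSucc) l : ℝ)) := by
      rw [eq_inv_smul_iff₀ hbp', eq_sub_iff_add_eq]
      have hexp : (fun l => (z (Fin.last i) l : ℝ)) =
          ∑ j, (b j : ℝ) • fun l => ((δ * γ) j l : ℝ) := by
        ext l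
        rw [← haz, ← hba, vecMul_vecMul]
        simp [vecMul, dotProduct]
      rw [hexp, ← Finset.sum_subset (Finset.subset_univ (insert p (Finset.univ.image
        fun k : Fin i => f k.castSucc))), Finset.sum_insert, Finset.sum_image]
      · congr 1
        refine Finset.sum_congr rfl fun k _ => ?_
        rw [hrow' _ (by simp [hs])]
      · exact fun x _ y _ h => Fin.castSucc_injective i (hf h)
      · simpa [hs] using hps
      · intro j _ hj
        simp only [Finset.mem_insert, Finset.mem_image, Finset.mem_univ, true_and, not_or] at hj
        rw [hzero j (by simpa [hs] using hj.2) hj.1]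
        simp
    refine ⟨δ * γ, by rw [det_mul, hδ1, hγ1, one_mul], fun k => ?_⟩
    refine Fin.lastCases ?_ (fun k => ?_) k
    · rw [← hp, hnew]
      constructor
      · have hpos : 0 < |(b p : ℝ)| := abs_pos.2 hbp'
        rw [map_smul_eq_mul, norm_inv, Real.norm_eq_abs, inv_mul_le_iff₀ hpos]
        have h1 : (1 : ℝ) ≤ |(b p : ℝ)| := by exact_mod_cast Int.one_le_abs hbp
        have hr : 0 ≤ r := (apply_nonneg N _).trans (hN (Fin.last i))
        calc _ ≤ N (fun l => (z (Fin.last i) l : ℝ)) +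
              N (∑ k : Fin i, (b (f k.castSucc) : ℝ) • fun l => (γ (f k.castSucc) l : ℝ)) :=
              map_sub_le_add _ _ _
          _ ≤ r + ∑ k : Fin i, |(b p : ℝ)| * (2 ^ (k : ℕ) * r) := by
              refine add_le_add (hN _) ((Finset.le_sum_of_subadditive N (map_zero N).le
                (map_add_le_add N) _ _).trans (Finset.sum_le_sum fun k _ => ?_))
              rw [map_smul_eq_mul, Real.norm_eq_abs]
              refine mul_le_mul ?_ (hγ k).1 (apply_nonneg _ _) hpos.le
              exact_mod_cast hle _ (by simp [hs])
          _ = r + |(b p : ℝ)| * ((2 ^ i - 1) * r) := by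
              rw [← Finset.mul_sum, ← Finset.sum_mul, Fin.sum_univ_eq_sum_range (fun k => (2 : ℝ) ^ k),
                geom_sum_eq (by norm_num)]
              norm_num
          _ ≤ |(b p : ℝ)| * (2 ^ i * r) := by nlinarith
          _ = _ := by simp
      · refine Submodule.smul_mem _ _ (Submodule.sub_mem _ (Submodule.subset_span ⟨_, rfl⟩)
          (Submodule.sum_mem _ fun k _ => Submodule.smul_mem _ _ (hmono (hγ k).2)))
    · rw [hrow' _ (by simp [hs])]
      exact ⟨(hγ k).1, hmono (hγ k).2⟩

/-! ### Lebesgue measure on matrices -/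

noncomputable instance Matrix.instMeasureSpaceReal {ι κ : Type*} [Fintype ι] [Fintype κ] :
    MeasureSpace (Matrix ι κ ℝ) :=
  inferInstanceAs (MeasureSpace (ι → κ → ℝ))

instance Matrix.instBorelSpaceReal {ι κ : Type*} [Fintype ι] [Fintype κ] :
    BorelSpace (Matrix ι κ ℝ) :=
  inferInstanceAs (BorelSpace (ι → κ → ℝ))

instance Matrix.instSigmaFiniteVolume {ι κ : Type*} [Fintype ι] [Fintype κ] :
    SigmaFinite (volume : Measure (Matrix ι κ ℝ)) :=
  inferInstanceAs (SigmaFinite (volume : Measure (ι → κ → ℝ)))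

instance Matrix.instIsAddHaarMeasureVolume {ι κ : Type*} [Fintype ι] [Fintype κ] :
    (volume : Measure (Matrix ι κ ℝ)).IsAddHaarMeasure :=
  Measure.pi.isAddHaarMeasure (fun _ : ι => (volume : Measure (κ → ℝ)))

instance Matrix.instSecondCountable {ι κ : Type*} [Fintype ι] [Fintype κ] :
    SecondCountableTopology (Matrix ι κ ℝ) :=
  inferInstanceAs (SecondCountableTopology (ι → κ → ℝ))

theorem measurePreserving_matrix_mul_right {ι κ : Type*} [Fintype ι] [Fintype κ] [DecidableEq κ]
    (k : Matrix κ κ ℝ) (hk : k.det = 1) :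
    MeasurePreserving (fun A : Matrix ι κ ℝ => A * k) := by
  have h : MeasurePreserving (fun v : κ → ℝ => v ᵥ* k) := by
    have hd : (toLin' kᵀ).det = 1 := by simp [hk]
    have := Real.map_linearMap_volume_pi_eq_smul_volume_pi (f := toLin' kᵀ) (by simp [hd])
    have hfun : (toLin' kᵀ : (κ → ℝ) → κ → ℝ) = fun v => v ᵥ* k := by
      ext1 v
      simp [mulVec_transpose]
    rw [hd, inv_one, abs_one, ENNReal.ofReal_one, one_smul, hfun] at this
    exact ⟨by fun_prop, this⟩
  exact volume_preserving_pi (fun _ : ι => h)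

/-- The transposition is a linear involution, so its determinant is `±1`. -/
theorem measurePreserving_matrix_transpose {κ : Type*} [Fintype κ] :
    MeasurePreserving (fun A : Matrix κ κ ℝ => Aᵀ) := by
  classical
  let f : (κ → κ → ℝ) →ₗ[ℝ] (κ → κ → ℝ) :=
    { toFun := fun A i j => A j i, map_add' := fun _ _ => rfl, map_smul' := fun _ _ => rfl }
  have hf : f.det * f.det = 1 := by
    rw [← LinearMap.det_comp]
    exact LinearMap.det_id
  have h0 : f.det ≠ 0 := fun h => by simp [h] at hf
  refine ⟨(continuous_id.matrix_transpose).measurable, ?_⟩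
  have := Measure.map_linearMap_addHaar_eq_smul_addHaar (volume : Measure (κ → κ → ℝ)) h0
  have h1 : |f.det⁻¹| = 1 := by
    rcases mul_self_eq_one_iff.1 hf with h | h <;> simp [h]
  rw [h1, ENNReal.ofReal_one, one_smul] at this
  exact this

theorem measurePreserving_matrix_mul_left {κ : Type*} [Fintype κ] [DecidableEq κ]
    (k : Matrix κ κ ℝ) (hk : k.det = 1) :
    MeasurePreserving (fun A : Matrix κ κ ℝ => k * A) := by
  have := measurePreserving_matrix_transpose.comp ((measurePreserving_matrix_mul_right kᵀ
    (by simpa using hk)).comp (measurePreserving_matrix_transpose (κ := κ)))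
  convert this using 2
  simp [Function.comp_def, transpose_mul]

theorem volume_det_eq_zero {κ : Type*} [Fintype κ] [DecidableEq κ] [Nonempty κ] :
    volume {A : Matrix κ κ ℝ | A.det = 0} = 0 := by
  set Z := {A : Matrix κ κ ℝ | A.det = 0} with hZ
  have hZm : MeasurableSet Z := (isClosed_eq (by fun_prop) continuous_const).measurableSet
  have hcont : Continuous fun q : ℝ × Matrix κ κ ℝ => q.1 • (1 : Matrix κ κ ℝ) + q.2 := by fun_prop
  have hWm : MeasurableSet ((fun q : ℝ × Matrix κ κ ℝ => q.1 • (1 : Matrix κ κ ℝ) + q.2) ⁻¹' Z) :=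
    hcont.measurable hZm
  -- Fubini on the set of pairs `(t, A)` with `t + A` singular: every slice at a fixed `A` is finite,
  -- every slice at a fixed `t` is a translate of `Z`.
  have h1 : ((volume : Measure ℝ).prod (volume : Measure (Matrix κ κ ℝ)))
      ((fun q : ℝ × Matrix κ κ ℝ => q.1 • (1 : Matrix κ κ ℝ) + q.2) ⁻¹' Z) = 0 := by
    rw [Measure.prod_apply_symm hWm, lintegral_eq_zero_iff
      (measurable_measure_prodMk_right hWm)]
    refine Filter.Eventually.of_forall fun A => ?_
    refine ((-A).charpoly.roots.toFinset.finite_toSet.subset fun t ht => ?_).measure_zero _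
    have hdet : (t • (1 : Matrix κ κ ℝ) + A).det = 0 := ht
    simp only [Finset.mem_coe, Multiset.mem_toFinset, Polynomial.mem_roots', Polynomial.IsRoot,
      eval_charpoly, scalar_apply, sub_neg_eq_add]
    exact ⟨(charpoly_monic _).ne_zero, by rwa [← smul_one_eq_diagonal]⟩
  rw [Measure.prod_apply hWm] at h1
  have h2 : ∀ t : ℝ, volume (Prod.mk t ⁻¹' ((fun q : ℝ × Matrix κ κ ℝ =>
      q.1 • (1 : Matrix κ κ ℝ) + q.2) ⁻¹' Z)) = volume Z := fun t =>
    measure_preimage_add volume (t • (1 : Matrix κ κ ℝ)) Z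
  simpa [h2] using h1

/-! ### Matrices with given upper rows -/

/-- A matrix with determinant `1` whose first rows are those of `B`, provided that the left square
block `B₁` of `B` is invertible: the block matrix `[B₁, B₂; 0, D]` with `D` diagonal, the entry of
`D` at `n₀` being `(det B₁)⁻¹` and the others `1`. -/
noncomputable def frame {m n : Type*} [Fintype m] [DecidableEq m] [DecidableEq n] (n₀ : n)
    (B : Matrix m (m ⊕ n) ℝ) : Matrix (m ⊕ n) (m ⊕ n) ℝ :=
  fromBlocks B.toCols₁ B.toCols₂ 0 (diagonal (Function.update 1 n₀ B.toCols₁.det⁻¹))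

/-- The lower rows of `A`, in coordinates with respect to the rows of the frame of the upper rows
of `A`. The adjugate of the frame is its inverse, as its determinant is `1`. -/
noncomputable def frameCoord {m n : Type*} [Fintype m] [Fintype n] [DecidableEq m] [DecidableEq n]
    (n₀ : n) (A : Matrix (m ⊕ n) (m ⊕ n) ℝ) : Matrix n (m ⊕ n) ℝ :=
  A.toRows₂ * (frame n₀ A.toRows₁).adjugate

/-- The matrices `A = [1, 0; Y, N] * frame n₀ B` with `B ∈ 𝔹`, the entries of `Y` in `[0, 1)` and
`N ∈ U`. -/
def framedSet {m n : Type*} [Fintype m] [Fintype n] [DecidableEq m] [DecidableEq n]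
    (n₀ : n) (𝔹 : Set (Matrix m (m ⊕ n) ℝ)) (U : Set (Matrix n n ℝ)) :
    Set (Matrix (m ⊕ n) (m ⊕ n) ℝ) :=
  {A | A.toRows₁ ∈ 𝔹 ∧ (∀ j k, (frameCoord n₀ A).toCols₁ j k ∈ Ico (0 : ℝ) 1) ∧
    (frameCoord n₀ A).toCols₂ ∈ U}

theorem measurePreserving_toRows {m n : Type*} [Fintype m] [Fintype n] :
    MeasurePreserving (fun A : Matrix (m ⊕ n) (m ⊕ n) ℝ => (A.toRows₁, A.toRows₂)) :=
  volume_measurePreserving_sumPiEquivProdPi fun _ : m ⊕ n => m ⊕ n → ℝ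

theorem measurePreserving_toCols {ι m n : Type*} [Fintype ι] [Fintype m] [Fintype n] :
    MeasurePreserving (fun A : Matrix ι (m ⊕ n) ℝ => (A.toCols₁, A.toCols₂)) :=
  (volume_measurePreserving_arrowProdEquivProdArrow (m → ℝ) (n → ℝ) ι).comp
    (volume_preserving_pi fun _ : ι => volume_measurePreserving_sumPiEquivProdPi fun _ : m ⊕ n => ℝ)

section
variable {m n : Type*} [Fintype m] [Fintype n] [DecidableEq m] [DecidableEq n]

theorem det_frame (n₀ : n) {B : Matrix m (m ⊕ n) ℝ} (hB : B.toCols₁.det ≠ 0) :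
    (frame n₀ B).det = 1 := by
  rw [frame, det_fromBlocks_zero₂₁, det_diagonal, Finset.prod_update_of_mem (Finset.mem_univ _)]
  simp [hB]

theorem toRows₁_fromBlocks_mul_frame (n₀ : n) (B : Matrix m (m ⊕ n) ℝ) (Y : Matrix n m ℝ)
    (N : Matrix n n ℝ) : (fromBlocks 1 0 Y N * frame n₀ B).toRows₁ = B := by
  rw [frame, fromBlocks_multiply]
  ext i (j | j) <;> simp [toRows₁]

theorem frameCoord_fromBlocks_mul_frame (n₀ : n) {B : Matrix m (m ⊕ n) ℝ}
    (hB : B.toCols₁.det ≠ 0) (Y : Matrix n m ℝ) (N : Matrix n n ℝ) :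
    frameCoord n₀ (fromBlocks 1 0 Y N * frame n₀ B) = fromCols Y N := by
  have h : ((fromBlocks 1 0 Y N : Matrix (m ⊕ n) (m ⊕ n) ℝ) * frame n₀ B).toRows₂ =
      fromCols Y N * frame n₀ B := by
    ext i j
    simp [toRows₂, Matrix.mul_apply, fromCols]
  rw [frameCoord, toRows₁_fromBlocks_mul_frame, h, Matrix.mul_assoc, mul_adjugate, det_frame n₀ hB,
    one_smul, Matrix.mul_one]

theorem eq_fromBlocks_mul_frame (n₀ : n) {A : Matrix (m ⊕ n) (m ⊕ n) ℝ}
    (hA : A.toRows₁.toCols₁.det ≠ 0) :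
    A = fromBlocks 1 0 (frameCoord n₀ A).toCols₁ (frameCoord n₀ A).toCols₂ *
      frame n₀ A.toRows₁ := by
  have h : frameCoord n₀ A * frame n₀ A.toRows₁ = A.toRows₂ := by
    rw [frameCoord, Matrix.mul_assoc, adjugate_mul, det_frame n₀ hA, one_smul, Matrix.mul_one]
  have h' := toRows₁_fromBlocks_mul_frame n₀ A.toRows₁ (frameCoord n₀ A).toCols₁
    (frameCoord n₀ A).toCols₂
  ext (i | i) j
  · exact congrFun₂ h'.symm i j
  · refine (congrFun₂ h.symm i j).trans ?_
    simp [Matrix.mul_apply]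

/-- The factor `[1, 0; Y, N]` of `A` has the determinant of `N`, the frame has determinant `1`. -/
theorem det_eq_det_frameCoord (n₀ : n) {A : Matrix (m ⊕ n) (m ⊕ n) ℝ}
    (hA : A.toRows₁.toCols₁.det ≠ 0) : A.det = (frameCoord n₀ A).toCols₂.det := by
  conv_lhs => rw [eq_fromBlocks_mul_frame n₀ hA]
  rw [det_mul, det_frame n₀ hA, det_fromBlocks_zero₁₂]
  simp

theorem measurable_frame (n₀ : n) : Measurable (frame (m := m) n₀) := by
  have h1 : Continuous fun B : Matrix m (m ⊕ n) ℝ => B.toCols₁ := by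
    refine continuous_matrix fun i j => ?_
    exact continuous_id.matrix_elem i (Sum.inl j)
  refine measurable_pi_lambda _ fun i => measurable_pi_lambda _ fun j => ?_
  rcases i with i | i <;> rcases j with j | j
  · exact (continuous_id.matrix_elem i (Sum.inl j)).measurable
  · exact (continuous_id.matrix_elem i (Sum.inr j)).measurable
  · exact measurable_const
  · simp only [frame, fromBlocks_apply₂₂, diagonal_apply, Function.update_apply]
    have := h1.matrix_det.measurable.inv
    split_ifs <;> fun_prop

theorem measurable_frameCoord (n₀ : n) : Measurable (frameCoord (m := m) n₀) := by
  have h1 : Continuous fun q : Matrix n (m ⊕ n) ℝ × Matrix (m ⊕ n) (m ⊕ n) ℝ =>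
    q.1 * q.2.adjugate := by fun_prop
  have h2 := (measurePreserving_toRows (m := m) (n := n)).measurable
  exact h1.measurable.comp (h2.snd.prodMk ((measurable_frame n₀).comp h2.fst))

theorem measurableSet_framedSet (n₀ : n) {𝔹 : Set (Matrix m (m ⊕ n) ℝ)} {U : Set (Matrix n n ℝ)}
    (h𝔹 : MeasurableSet 𝔹) (hU : MeasurableSet U) : MeasurableSet (framedSet n₀ 𝔹 U) := by
  have h2 := (measurePreserving_toRows (m := m) (n := n)).measurable
  have h3 := (measurePreserving_toCols (ι := n) (m := m) (n := n)).measurable.comp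
    (measurable_frameCoord (m := m) n₀)
  refine (h2.fst h𝔹).inter (MeasurableSet.inter ?_ (h3.snd hU))
  have : MeasurableSet {Y : Matrix n m ℝ | ∀ j k, Y j k ∈ Ico (0 : ℝ) 1} := by
    simp only [ofPred_forall]
    refine MeasurableSet.iInter fun j => MeasurableSet.iInter fun k => ?_
    exact (continuous_id.matrix_elem j k).measurable measurableSet_Ico
  exact h3.fst this

/-- Lebesgue measure is a product measure in the coordinates `(B, Y, N)`: for a fixed `B`, the lower
rows are the image of `[Y, N]` under the multiplication by a matrix of determinant `1`. -/
theorem volume_framedSet (n₀ : n) {𝔹 : Set (Matrix m (m ⊕ n) ℝ)} {U : Set (Matrix n n ℝ)}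
    (h𝔹 : MeasurableSet 𝔹) (hU : MeasurableSet U) (h0 : ∀ B ∈ 𝔹, B.toCols₁.det ≠ 0) :
    volume (framedSet n₀ 𝔹 U) = volume 𝔹 * volume U := by
  set T : Set (Matrix n (m ⊕ n) ℝ) := {W | (∀ j k, W.toCols₁ j k ∈ Ico (0 : ℝ) 1) ∧ W.toCols₂ ∈ U}
    with hT
  have hbox : {Y : Matrix n m ℝ | ∀ j k, Y j k ∈ Ico (0 : ℝ) 1} =
      univ.pi fun _ : n => univ.pi fun _ : m => Ico (0 : ℝ) 1 := by
    ext Y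
    exact ⟨fun h j _ k _ => h j k, fun h j k => h j trivial k trivial⟩
  have hboxm : MeasurableSet {Y : Matrix n m ℝ | ∀ j k, Y j k ∈ Ico (0 : ℝ) 1} := by
    rw [hbox]
    exact MeasurableSet.univ_pi fun _ => MeasurableSet.univ_pi fun _ => measurableSet_Ico
  have hTm : MeasurableSet T := measurePreserving_toCols.measurable (hboxm.prod hU)
  have hTvol : volume T = volume U := by
    have : volume {Y : Matrix n m ℝ | ∀ j k, Y j k ∈ Ico (0 : ℝ) 1} = 1 := by
      rw [hbox]
      refine (volume_pi_pi _).trans ?_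
      simp [volume_pi_pi]
    rw [← one_mul (volume U), ← this, ← Measure.prod_prod]
    exact measurePreserving_toCols.measure_preimage (hboxm.prod hU).nullMeasurableSet
  set R : Set (Matrix m (m ⊕ n) ℝ × Matrix n (m ⊕ n) ℝ) :=
    {q | q.1 ∈ 𝔹 ∧ q.2 * (frame n₀ q.1).adjugate ∈ T} with hR
  have hRm : MeasurableSet R := by
    have h1 : Continuous fun q : Matrix n (m ⊕ n) ℝ × Matrix (m ⊕ n) (m ⊕ n) ℝ =>
      q.1 * q.2.adjugate := by fun_prop
    refine (measurable_fst h𝔹).inter ?_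
    exact (h1.measurable.comp
      (measurable_snd.prodMk ((measurable_frame n₀).comp measurable_fst))) hTm
  have h1 : volume (framedSet n₀ 𝔹 U) = volume R :=
    measurePreserving_toRows.measure_preimage hRm.nullMeasurableSet
  rw [h1, Measure.volume_eq_prod, Measure.prod_apply hRm]
  have h2 : ∀ B, volume (Prod.mk B ⁻¹' R) = 𝔹.indicator (fun _ => volume U) B := by
    intro B
    by_cases hB : B ∈ 𝔹
    · have hdet : (frame n₀ B).adjugate.det = 1 := by
        rw [det_adjugate, det_frame n₀ (h0 B hB), one_pow]
      have : Prod.mk B ⁻¹' R = (fun W => W * (frame n₀ B).adjugate) ⁻¹' T := by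
        ext W
        simp [hR, hB]
      rw [this, (measurePreserving_matrix_mul_right _ hdet).measure_preimage hTm.nullMeasurableSet,
        hTvol, indicator_of_mem hB]
    · have : Prod.mk B ⁻¹' R = ∅ := by
        ext W
        simp [hR, hB]
      rw [this, measure_empty, indicator_of_notMem hB]
  simp_rw [h2]
  rw [lintegral_indicator_const h𝔹, mul_comm]

end

/-! ### Sets that cover all lattices -/

/-- Minkowski's theorem for the lattice spanned by the rows of `A`, whose covolume is at most `1`, and
the cube with side `4`. -/
theorem exists_integer_vecMul_lt_two {κ : Type*} [Fintype κ] [DecidableEq κ] [Nonempty κ]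
    (A : Matrix κ κ ℝ) (hA : A.det ∈ Ioc (0 : ℝ) 1) :
    ∃ z : κ → ℤ, z ≠ 0 ∧ ‖(fun l => (z l : ℝ)) ᵥ* A‖ < 2 := by
  set f : (κ → ℝ) →ₗ[ℝ] (κ → ℝ) := A.vecMulLinear with hf
  have hdet : f.det = A.det := by
    have : f = toLin' Aᵀ := by
      refine LinearMap.ext fun v => ?_
      simp [hf, mulVec_transpose]
    rw [this, LinearMap.det_toLin', det_transpose]
  have hvol : volume (f ⁻¹' Metric.ball 0 2) =
      ENNReal.ofReal |A.det⁻¹| * ENNReal.ofReal (4 ^ Fintype.card κ) := by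
    rw [Measure.addHaar_preimage_linearMap volume (by rw [hdet]; exact hA.1.ne'),
      Real.volume_pi_ball _ (by norm_num), hdet]
    norm_num
  have : Countable (Submodule.span ℤ (range (Pi.basisFun ℝ κ))).toAddSubgroup :=
    inferInstanceAs (Countable (Submodule.span ℤ (range (Pi.basisFun ℝ κ))))
  obtain ⟨x, hx0, hx⟩ := exists_ne_zero_mem_lattice_of_measure_mul_two_pow_lt_measure
    (μ := volume) (s := f ⁻¹' Metric.ball 0 2) (ZSpan.isAddFundamentalDomain' (Pi.basisFun ℝ κ) volume)
    (fun x hx => by simpa using hx) ((convex_ball _ _).linear_preimage f) (by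
      rw [ZSpan.fundamentalDomain_pi_basisFun, volume_pi_pi, hvol,
        ← ENNReal.ofReal_mul (abs_nonneg _)]
      simp only [Real.volume_Ico, sub_zero, ENNReal.ofReal_one, Finset.prod_const_one, one_mul,
        Module.finrank_fintype_fun_eq_card]
      rw [← ENNReal.ofReal_ofNat, ← ENNReal.ofReal_pow (by norm_num)]
      refine (ENNReal.ofReal_lt_ofReal_iff (by have := hA.1; positivity)).2 ?_
      have h1 : (1 : ℝ) ≤ |A.det⁻¹| := by
        rw [abs_of_pos (inv_pos.2 hA.1)]
        exact (one_le_inv₀ hA.1).2 hA.2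
      calc (2 : ℝ) ^ Fintype.card κ < 4 ^ Fintype.card κ :=
            pow_lt_pow_left₀ (by norm_num) (by norm_num) Fintype.card_ne_zero
        _ ≤ _ := le_mul_of_one_le_left (by positivity) h1)
  have hmem := ((Pi.basisFun ℝ κ).mem_span_iff_repr_mem ℤ (x : κ → ℝ)).1 x.2
  choose z hz using hmem
  have hzx : (fun l => (z l : ℝ)) = (x : κ → ℝ) := by
    ext l
    simpa using hz l
  refine ⟨z, ?_, ?_⟩
  · rintro rfl
    refine hx0 (Subtype.ext ?_)
    rw [← hzx]
    ext
    simp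
  · rw [hzx]
    simpa [hf] using hx

/-- `U` meets every orbit of `SL(κ, ℤ)` on the matrices with determinant in `(0, 1]`, for its
action by left multiplication, that is, by change of basis of the lattice spanned by the rows. -/
def CoversLattices {κ : Type*} [Fintype κ] [DecidableEq κ] (U : Set (Matrix κ κ ℝ)) : Prop :=
  ∀ A : Matrix κ κ ℝ, A.det ∈ Ioc (0 : ℝ) 1 →
    ∃ γ : Matrix κ κ ℤ, γ.det = 1 ∧ γ.map (Int.cast : ℤ → ℝ) * A ∈ U

theorem det_map_intCast {κ : Type*} [Fintype κ] [DecidableEq κ] (γ : Matrix κ κ ℤ) :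
    (γ.map (Int.cast : ℤ → ℝ)).det = γ.det := (Int.cast_det γ).symm

theorem map_intCast_mul {ι κ μ : Type*} [Fintype κ] (γ : Matrix ι κ ℤ)
    (δ : Matrix κ μ ℤ) : (γ * δ).map (Int.cast : ℤ → ℝ) =
      γ.map (Int.cast : ℤ → ℝ) * δ.map (Int.cast : ℤ → ℝ) := by
  ext
  simp [Matrix.mul_apply]

theorem volume_forall_abs_le {ι κ : Type*} [Fintype ι] [Fintype κ] {R : ℝ} (hR : 0 ≤ R) :
    volume {B : Matrix ι κ ℝ | ∀ i j, |B i j| ≤ R} =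
      ENNReal.ofReal ((2 * R) ^ (Fintype.card ι * Fintype.card κ)) := by
  have : {B : Matrix ι κ ℝ | ∀ i j, |B i j| ≤ R} =
      univ.pi fun _ : ι => univ.pi fun _ : κ => Icc (-R) R := by
    ext Y
    exact ⟨fun h i _ j _ => abs_le.1 (h i j), fun h i j => abs_le.2 (h i trivial j trivial)⟩
  rw [this]
  refine (volume_pi_pi _).trans ?_
  simp only [volume_pi_pi, Real.volume_Icc, Finset.prod_const, Finset.card_univ]
  rw [← pow_mul, ← ENNReal.ofReal_pow (by linarith), mul_comm]
  congr 2
  ring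

theorem measurableSet_forall_abs_le {ι κ : Type*} [Fintype ι] [Fintype κ] (R : ℝ) :
    MeasurableSet {B : Matrix ι κ ℝ | ∀ i j, |B i j| ≤ R} := by
  simp only [ofPred_forall]
  refine MeasurableSet.iInter fun i => MeasurableSet.iInter fun j => ?_
  exact (isClosed_le (continuous_id.matrix_elem i j).abs continuous_const).measurableSet

/-- Reduce `N` into `U`, and then `Y` into the unit cube by adding integral multiples of the upper
rows. -/
theorem exists_mul_mem_framedSet {m n : Type*} [Fintype m] [Fintype n] [DecidableEq m]
    [DecidableEq n] (n₀ : n) {U : Set (Matrix n n ℝ)} (hU : CoversLattices U)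
    (𝔹 : Set (Matrix m (m ⊕ n) ℝ)) (A : Matrix (m ⊕ n) (m ⊕ n) ℝ) (hA : A.det ∈ Ioc (0 : ℝ) 1)
    (hB : A.toRows₁ ∈ 𝔹) (h0 : A.toRows₁.toCols₁.det ≠ 0) :
    ∃ γ : Matrix (m ⊕ n) (m ⊕ n) ℤ, γ.det = 1 ∧
      γ.map (Int.cast : ℤ → ℝ) * A ∈ framedSet n₀ 𝔹 U := by
  set Y := (frameCoord n₀ A).toCols₁
  set N := (frameCoord n₀ A).toCols₂ with hN
  obtain ⟨γ, hγ, hγU⟩ := hU N (by rwa [hN, ← det_eq_det_frameCoord n₀ h0])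
  set C : Matrix n m ℤ := of fun j k => -⌊(γ.map (Int.cast : ℤ → ℝ) * Y) j k⌋ with hC
  refine ⟨fromBlocks 1 0 C γ, by simp [hγ], ?_⟩
  have hprod : (fromBlocks 1 0 C γ : Matrix (m ⊕ n) (m ⊕ n) ℤ).map (Int.cast : ℤ → ℝ) * A =
      fromBlocks 1 0 (C.map (Int.cast : ℤ → ℝ) + γ.map (Int.cast : ℤ → ℝ) * Y)
        (γ.map (Int.cast : ℤ → ℝ) * N) * frame n₀ A.toRows₁ := by
    conv_lhs => rw [eq_fromBlocks_mul_frame n₀ h0]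
    rw [← Matrix.mul_assoc, fromBlocks_map, fromBlocks_multiply]
    simp [Y, N]
  rw [hprod]
  refine ⟨by rwa [toRows₁_fromBlocks_mul_frame], fun j k => ?_, ?_⟩
  · rw [frameCoord_fromBlocks_mul_frame n₀ h0, toCols₁_fromCols]
    have : (C.map (Int.cast : ℤ → ℝ) + γ.map (Int.cast : ℤ → ℝ) * Y) j k =
        Int.fract ((γ.map (Int.cast : ℤ → ℝ) * Y) j k) := by
      rw [Matrix.add_apply, map_apply, hC, of_apply, Int.cast_neg, Int.fract]
      ring
    rw [this]
    exact ⟨Int.fract_nonneg _, Int.fract_lt_one _⟩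
  · rwa [frameCoord_fromBlocks_mul_frame n₀ h0, toCols₂_fromCols]

theorem volume_upperLeft_det_eq_zero {m n : Type*} [Fintype m] [Fintype n] [DecidableEq m]
    [Nonempty m] :
    volume {A : Matrix (m ⊕ n) (m ⊕ n) ℝ | A.toRows₁.toCols₁.det = 0} = 0 := by
  have h1 : volume {B : Matrix m (m ⊕ n) ℝ | B.toCols₁.det = 0} = 0 := by
    have hpre : {B : Matrix m (m ⊕ n) ℝ | B.toCols₁.det = 0} =
        (fun B => (B.toCols₁, B.toCols₂)) ⁻¹' ({C : Matrix m m ℝ | C.det = 0} ×ˢ univ) := by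
      ext
      simp
    rw [hpre]
    refine (measurePreserving_toCols (ι := m) (m := m) (n := n)).quasiMeasurePreserving.preimage_null ?_
    rw [Measure.volume_eq_prod, Measure.prod_prod, volume_det_eq_zero, zero_mul]
  have hpre : {A : Matrix (m ⊕ n) (m ⊕ n) ℝ | A.toRows₁.toCols₁.det = 0} =
      (fun A => (A.toRows₁, A.toRows₂)) ⁻¹'
        ({B : Matrix m (m ⊕ n) ℝ | B.toCols₁.det = 0} ×ˢ univ) := by
    ext
    simp
  rw [hpre]
  refine (measurePreserving_toRows (m := m) (n := n)).quasiMeasurePreserving.preimage_null ?_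
  rw [Measure.volume_eq_prod, Measure.prod_prod, h1, zero_mul]

/-- The lattices with `i` independent vectors of size at most `r` have bases in a set of volume
`O(r ^ (i * d))`, where `d` is the dimension. -/
theorem exists_cover_of_short_vectors {i : ℕ} (hi : 0 < i) {n : Type*} [Fintype n] [DecidableEq n]
    (n₀ : n) {U : Set (Matrix n n ℝ)} (hUm : MeasurableSet U) (hU : CoversLattices U)
    {r : ℝ} (hr : 0 ≤ r) :
    ∃ S : Set (Matrix (Fin i ⊕ n) (Fin i ⊕ n) ℝ), MeasurableSet S ∧
      volume S ≤ ENNReal.ofReal ((2 * (2 ^ i * r)) ^ (i * (i + Fintype.card n))) * volume U ∧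
      ∀ A : Matrix (Fin i ⊕ n) (Fin i ⊕ n) ℝ, A.det ∈ Ioc (0 : ℝ) 1 →
        (∃ z : Fin i → Fin i ⊕ n → ℤ, LinearIndependent ℝ (fun k l => (z k l : ℝ)) ∧
          ∀ k, ‖(fun l => (z k l : ℝ)) ᵥ* A‖ ≤ r) →
        ∃ γ : Matrix (Fin i ⊕ n) (Fin i ⊕ n) ℤ, γ.det = 1 ∧ γ.map (Int.cast : ℤ → ℝ) * A ∈ S := by
  have : Nonempty (Fin i) := ⟨⟨0, hi⟩⟩
  set R := 2 ^ i * r with hR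
  have hR0 : 0 ≤ R := by positivity
  -- The matrices without a frame form a null set, which is simply added to the covering set.
  set Z : Set (Matrix (Fin i ⊕ n) (Fin i ⊕ n) ℝ) := {A | A.toRows₁.toCols₁.det = 0} with hZ
  set 𝔹 : Set (Matrix (Fin i) (Fin i ⊕ n) ℝ) :=
    {B | ∀ k l, |B k l| ≤ R} ∩ {B | B.toCols₁.det ≠ 0} with h𝔹
  have hD : Continuous fun B : Matrix (Fin i) (Fin i ⊕ n) ℝ => B.toCols₁.det := by
    refine Continuous.matrix_det (continuous_matrix fun k l => ?_)
    exact continuous_id.matrix_elem k (Sum.inl l)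
  have hE : Continuous fun A : Matrix (Fin i ⊕ n) (Fin i ⊕ n) ℝ => A.toRows₁.toCols₁.det := by
    refine Continuous.matrix_det (continuous_matrix fun k l => ?_)
    exact continuous_id.matrix_elem (Sum.inl k) (Sum.inl l)
  have h𝔹m : MeasurableSet 𝔹 :=
    (measurableSet_forall_abs_le R).inter (isOpen_ne_fun hD continuous_const).measurableSet
  refine ⟨framedSet n₀ 𝔹 U ∪ Z, (measurableSet_framedSet n₀ h𝔹m hUm).union
    (isClosed_eq hE continuous_const).measurableSet, ?_, ?_⟩
  · refine (measure_union_le _ _).trans ?_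
    rw [hZ, volume_upperLeft_det_eq_zero, add_zero, volume_framedSet n₀ h𝔹m hUm fun B hB => hB.2]
    gcongr
    refine (measure_mono inter_subset_left).trans ?_
    rw [volume_forall_abs_le hR0]
    simp
  · rintro A hA ⟨z, hz, hzr⟩
    obtain ⟨γ, hγ, hγr⟩ := exists_specialLinearGroup_rows_le
      ((normSeminorm ℝ (Fin i ⊕ n → ℝ)).comp A.vecMulLinear) r i z hz hzr Sum.inl
      Sum.inl_injective
    set A' := γ.map (Int.cast : ℤ → ℝ) * A with hA'
    have hdet : A'.det = A.det := by rw [hA', det_mul, det_map_intCast, hγ]; simp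
    by_cases h0 : A'.toRows₁.toCols₁.det = 0
    · exact ⟨γ, hγ, Or.inr h0⟩
    · have hmem : A'.toRows₁ ∈ 𝔹 := by
        refine ⟨fun k l => ?_, h0⟩
        refine (norm_le_pi_norm (A' (Sum.inl k)) l).trans (((hγr k).1).trans ?_)
        exact mul_le_mul_of_nonneg_right (pow_le_pow_right₀ (by norm_num) k.2.le) hr
      obtain ⟨γ', hγ', hmem'⟩ := exists_mul_mem_framedSet n₀ hU 𝔹 A' (by rwa [hdet]) hmem h0
      refine ⟨γ' * γ, by rw [det_mul, hγ, hγ', one_mul], Or.inl ?_⟩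
      rwa [map_intCast_mul, Matrix.mul_assoc]

theorem measurePreserving_submatrix {κ κ' : Type*} [Fintype κ] [Fintype κ'] (e : κ ≃ κ') :
    MeasurePreserving (fun A : Matrix κ κ ℝ => A.submatrix e.symm e.symm) :=
  volume_preserving_arrowCongr' e (MeasurableEquiv.arrowCongr' e (MeasurableEquiv.refl ℝ))
    (volume_preserving_arrowCongr' e (MeasurableEquiv.refl ℝ) (MeasurePreserving.id _))

theorem exists_map_mul_mem_preimage_submatrix {κ κ' : Type*} [Fintype κ] [Fintype κ']
    [DecidableEq κ] [DecidableEq κ'] (e : κ ≃ κ') {U : Set (Matrix κ κ ℝ)} {A : Matrix κ' κ' ℝ}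
    (h : ∃ γ : Matrix κ κ ℤ, γ.det = 1 ∧ γ.map (Int.cast : ℤ → ℝ) * A.submatrix e e ∈ U) :
    ∃ γ : Matrix κ' κ' ℤ, γ.det = 1 ∧
      γ.map (Int.cast : ℤ → ℝ) * A ∈ (fun A : Matrix κ' κ' ℝ => A.submatrix e e) ⁻¹' U := by
  obtain ⟨γ, hγ, h⟩ := h
  refine ⟨γ.submatrix e.symm e.symm, by rwa [det_submatrix_equiv_self], ?_⟩
  rw [mem_preimage, ← submatrix_mul_equiv _ _ e e e, submatrix_map]
  simpa using h

theorem CoversLattices.submatrix {κ κ' : Type*} [Fintype κ] [Fintype κ'] [DecidableEq κ]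
    [DecidableEq κ'] (e : κ ≃ κ') {U : Set (Matrix κ κ ℝ)} (hU : CoversLattices U) :
    CoversLattices ((fun A : Matrix κ' κ' ℝ => A.submatrix e e) ⁻¹' U) := fun A hA =>
  exists_map_mul_mem_preimage_submatrix e (hU _ (by rwa [det_submatrix_equiv_self]))

/-- The space of lattices has finite volume: by Minkowski's theorem
every lattice has a basis whose first vector is bounded, and the remaining vectors are reduced
modulo the first one and by induction on the dimension. -/
theorem exists_coversLattices_volume_lt_top (d : ℕ) :
    ∃ U : Set (Matrix (Fin (d + 1)) (Fin (d + 1)) ℝ), MeasurableSet U ∧ volume U < ⊤ ∧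
      CoversLattices U := by
  induction d with
  | zero =>
    have : Unique (Fin (0 + 1)) := inferInstanceAs (Unique (Fin 1))
    refine ⟨{B | ∀ i j, |B i j| ≤ 1}, measurableSet_forall_abs_le 1, ?_, fun A hA =>
      ⟨1, det_one, ?_⟩⟩
    · rw [volume_forall_abs_le zero_le_one]
      exact ENNReal.ofReal_lt_top
    · intro i j
      have h : A.det = A i j := by rw [det_unique, Subsingleton.elim i, Subsingleton.elim j]
      simp only [Matrix.map_one _ Int.cast_zero Int.cast_one, Matrix.one_mul, ← h]
      exact abs_le.2 ⟨by linarith [hA.1], hA.2⟩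
  | succ d ih =>
    obtain ⟨U, hUm, hUv, hU⟩ := ih
    obtain ⟨S, hSm, hSv, hS⟩ := exists_cover_of_short_vectors one_pos (0 : Fin (d + 1)) hUm hU
      zero_le_two
    have hScov : CoversLattices S := by
      intro A hA
      refine hS A hA ?_
      obtain ⟨z, hz0, hz⟩ := exists_integer_vecMul_lt_two A hA
      refine ⟨fun _ => z, LinearIndependent.of_subsingleton 0 fun h => hz0 ?_, fun _ => hz.le⟩
      ext l
      have : (z l : ℝ) = 0 := congrFun h l
      exact_mod_cast this
    let e : Fin 1 ⊕ Fin (d + 1) ≃ Fin (d + 2) := finSumFinEquiv.trans (finCongr (by omega))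
    have he := measurePreserving_submatrix e.symm
    refine ⟨_, he.measurable hSm, ?_, hScov.submatrix e⟩
    rw [he.measure_preimage hSm.nullMeasurableSet]
    exact hSv.trans_lt (ENNReal.mul_lt_top ENNReal.ofReal_lt_top hUv)

/-! ### A set that represents each lattice at most once -/

/-- A matrix close to the scalar matrix `c` cannot shrink a vector by more than the factor `c / 2`,
in the sup norm. -/
theorem abs_mul_le_of_near_scalar {m : Type*} [Fintype m] [DecidableEq m] {W : Matrix m m ℝ} {c : ℝ}
    (hW : ∀ i j, |W i j - c * (1 : Matrix m m ℝ) i j| ≤ c / (2 * Fintype.card m)) {q : m → ℝ}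
    {b : ℝ} (hq : ∀ j, |(q ᵥ* W) j| ≤ b) (i : m) : |q i| * c ≤ 2 * b := by
  have : Nonempty m := ⟨i⟩
  obtain ⟨k, hk⟩ := Finite.exists_max fun i => |q i|
  have hcard : (0 : ℝ) < Fintype.card m := by exact_mod_cast Fintype.card_pos
  have hc : 0 ≤ c := by
    have := (abs_nonneg _).trans (hW i i)
    rwa [le_div_iff₀ (by positivity), zero_mul] at this
  have hsum : (q ᵥ* W) k = c * q k + ∑ j, q j * (W j k - c * (1 : Matrix m m ℝ) j k) := by
    simp only [vecMul, dotProduct, mul_sub, Finset.sum_sub_distrib, Matrix.one_apply]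
    simp
    ring
  have herr : |∑ j, q j * (W j k - c * (1 : Matrix m m ℝ) j k)| ≤ |q k| * c / 2 := by
    calc _ ≤ ∑ j, |q j * (W j k - c * (1 : Matrix m m ℝ) j k)| := Finset.abs_sum_le_sum_abs _ _
      _ ≤ ∑ _j : m, |q k| * (c / (2 * Fintype.card m)) := Finset.sum_le_sum fun j _ => by
          rw [abs_mul]
          exact mul_le_mul (hk j) (hW j k) (abs_nonneg _) (abs_nonneg _)
      _ = _ := by
          rw [Finset.sum_const, Finset.card_univ, nsmul_eq_mul]
          field_simp
  have h1 : |c * q k| ≤ b + |q k| * c / 2 := by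
    have : c * q k = (q ᵥ* W) k - ∑ j, q j * (W j k - c * (1 : Matrix m m ℝ) j k) := by
      rw [hsum]; ring
    rw [this]
    exact (abs_sub _ _).trans (add_le_add (hq k) herr)
  rw [abs_mul, abs_of_nonneg hc] at h1
  have := mul_le_mul_of_nonneg_right (hk i) hc
  linarith

/-- Rows of an integral matrix that are less than `1` in size vanish. -/
theorem eq_zero_of_near_scalar {ι m : Type*} [Fintype m] [DecidableEq m]
    {W : Matrix m m ℝ} {c : ℝ}
    (hW : ∀ i j, |W i j - c * (1 : Matrix m m ℝ) i j| ≤ c / (2 * Fintype.card m))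
    (G : Matrix ι m ℤ) {b : ℝ} (hbc : 2 * b < c)
    (hG : ∀ i j, |(G.map (Int.cast : ℤ → ℝ) * W) i j| ≤ b) : G = 0 := by
  ext i j
  have h := abs_mul_le_of_near_scalar hW (q := fun j => (G i j : ℝ)) (b := b) (fun k => hG i k) j
  have hb : 0 ≤ b := (abs_nonneg _).trans (hG i j)
  have h1 : |(G i j : ℝ)| < 1 := by
    by_contra! h1
    nlinarith
  have h2 : |G i j| < 1 := by exact_mod_cast h1
  simpa using Int.abs_lt_one_iff.1 h2

theorem det_ne_zero_of_near_scalar {m : Type*} [Fintype m] [DecidableEq m] {W : Matrix m m ℝ}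
    {c : ℝ} (hc : 0 < c)
    (hW : ∀ i j, |W i j - c * (1 : Matrix m m ℝ) i j| ≤ c / (2 * Fintype.card m)) : W.det ≠ 0 := by
  intro h
  obtain ⟨v, hv0, hv⟩ := exists_vecMul_eq_zero_iff.2 h
  refine hv0 (funext fun i => ?_)
  have := abs_mul_le_of_near_scalar hW (q := v) (b := 0) (fun j => by simp [hv]) i
  have h1 : |v i| ≤ 0 := by nlinarith [abs_nonneg (v i)]
  simpa using h1

/-- The families of `m` vectors that are close to `δ` times the first unit vectors, up to an error
`δ * ε` in each entry. -/
def nearScaledId (m n : Type*) [DecidableEq m] (ε δ : ℝ) : Set (Matrix m (m ⊕ n) ℝ) :=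
  {B | ∀ i j, |B i j - δ * (fromCols 1 0 : Matrix m (m ⊕ n) ℝ) i j| ≤ δ * ε}

theorem measurableSet_nearScaledId {m n : Type*} [Fintype m] [Fintype n] [DecidableEq m]
    (ε δ : ℝ) : MeasurableSet (nearScaledId m n ε δ) := by
  simp only [nearScaledId, ofPred_forall]
  refine MeasurableSet.iInter fun i => MeasurableSet.iInter fun j => ?_
  exact (isClosed_le ((continuous_id.matrix_elem i j).sub continuous_const).abs
    continuous_const).measurableSet

/-- The power of `δ` that occurs here is the one in the distribution of the successive minima. -/
theorem volume_nearScaledId {m n : Type*} [Fintype m] [Fintype n] [DecidableEq m]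
    {ε δ : ℝ} (hε : 0 ≤ ε) (hδ : 0 ≤ δ) :
    volume (nearScaledId m n ε δ) =
      ENNReal.ofReal (δ ^ (Fintype.card m * Fintype.card (m ⊕ n))) *
        ENNReal.ofReal ((2 * ε) ^ (Fintype.card m * Fintype.card (m ⊕ n))) := by
  have h : nearScaledId m n ε δ = (fun B => -(δ • (fromCols 1 0 : Matrix m (m ⊕ n) ℝ)) + B) ⁻¹'
      {B | ∀ i j, |B i j| ≤ δ * ε} := by
    ext B
    simp [nearScaledId, neg_add_eq_sub]
  rw [h, measure_preimage_add, volume_forall_abs_le (by positivity), ← ENNReal.ofReal_mul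
    (by positivity), ← mul_pow]
  congr 2
  ring

section
variable {m n : Type*} [Fintype m] [Fintype n] [DecidableEq m] [DecidableEq n]

theorem fromBlocks_mul_framed_eq (n₀ : n) (A : Matrix (m ⊕ n) (m ⊕ n) ℝ)
    (h0 : A.toRows₁.toCols₁.det ≠ 0) (P : Matrix m m ℝ) (Q : Matrix m n ℝ) (R : Matrix n m ℝ)
    (S : Matrix n n ℝ) :
    fromBlocks P Q R S * A =
      fromBlocks (P + Q * (frameCoord n₀ A).toCols₁) (Q * (frameCoord n₀ A).toCols₂)
        (R + S * (frameCoord n₀ A).toCols₁) (S * (frameCoord n₀ A).toCols₂) *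
        frame n₀ A.toRows₁ := by
  conv_lhs => rw [eq_fromBlocks_mul_frame n₀ h0]
  rw [← Matrix.mul_assoc, fromBlocks_multiply]
  simp

theorem toRows₁_fromBlocks_mul_frame_eq_fromCols (n₀ : n) (B : Matrix m (m ⊕ n) ℝ) (P : Matrix m m ℝ)
    (Q : Matrix m n ℝ) (R : Matrix n m ℝ) (S : Matrix n n ℝ) :
    (fromBlocks P Q R S * frame n₀ B).toRows₁ = fromCols (P * B.toCols₁) (P * B.toCols₂ +
      Q * diagonal (Function.update 1 n₀ B.toCols₁.det⁻¹)) := by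
  rw [frame, fromBlocks_multiply]
  ext i (j | j) <;> simp [toRows₁]

/-- The matrices of a framed set over small, nearly orthogonal upper rows span different lattices:
the short vectors of the lattice lie in the span of the upper rows, which thus are determined by
the lattice up to a unimodular integral matrix, and this matrix is close to `1`. -/
theorem eq_one_of_mul_mem_framedSet (n₀ : n) {ε δ : ℝ} [Nonempty m]
    (hε : ε = 1 / (8 * (Fintype.card m + Fintype.card n))) (hδ : 0 < δ) (hδ' : δ < 1 / 16)
    (hδdet : ∀ B ∈ nearScaledId m n ε δ, |B.toCols₁.det| ≤ 1)
    {U : Set (Matrix n n ℝ)} (hU : ∀ N ∈ U, ∀ i j, |N i j - 1 / 2 * (1 : Matrix n n ℝ) i j| ≤ ε)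
    {A : Matrix (m ⊕ n) (m ⊕ n) ℝ} (hA : A ∈ framedSet n₀ (nearScaledId m n ε δ) U)
    (γ : Matrix (m ⊕ n) (m ⊕ n) ℤ)
    (hγA : γ.map (Int.cast : ℤ → ℝ) * A ∈ framedSet n₀ (nearScaledId m n ε δ) U) : γ = 1 := by
  have : Nonempty n := ⟨n₀⟩
  have hm : (1 : ℝ) ≤ Fintype.card m := by exact_mod_cast Fintype.card_pos
  have hn : (1 : ℝ) ≤ Fintype.card n := by exact_mod_cast Fintype.card_pos
  have hε0 : 0 < ε := by rw [hε]; positivity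
  have hεle : ε ≤ 1 / 16 := by
    rw [hε]
    exact one_div_le_one_div_of_le (by norm_num) (by linarith)
  have hmε : Fintype.card m * ε ≤ 1 / 8 := by
    rw [hε, mul_one_div, div_le_div_iff₀ (by positivity) (by norm_num)]
    linarith
  have hnearB : ∀ B ∈ nearScaledId m n ε δ, ∀ i j,
      |B.toCols₁ i j - δ * (1 : Matrix m m ℝ) i j| ≤ δ / (2 * Fintype.card m) := by
    intro B hB i j
    refine (hB i (Sum.inl j)).trans ?_
    rw [le_div_iff₀ (by positivity)]
    nlinarith
  have hnearN : ∀ N ∈ U, ∀ i j,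
      |N i j - 1 / 2 * (1 : Matrix n n ℝ) i j| ≤ 1 / 2 / (2 * Fintype.card n) := by
    intro N hN i j
    refine (hU N hN i j).trans ?_
    rw [hε, div_div]
    exact one_div_le_one_div_of_le (by positivity) (by linarith)
  obtain ⟨P, Q, R, S, rfl⟩ : ∃ P Q R S, γ = fromBlocks P Q R S :=
    ⟨_, _, _, _, (fromBlocks_toBlocks γ).symm⟩
  obtain ⟨hB, hY, hN⟩ := hA
  set B := A.toRows₁ with hBdef
  set Y := (frameCoord n₀ A).toCols₁
  set N := (frameCoord n₀ A).toCols₂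
  have h0 : B.toCols₁.det ≠ 0 := det_ne_zero_of_near_scalar hδ (hnearB B hB)
  rw [fromBlocks_map, fromBlocks_mul_framed_eq n₀ A h0, ← hBdef] at hγA
  obtain ⟨hB', hY', hN'⟩ := hγA
  rw [toRows₁_fromBlocks_mul_frame_eq_fromCols] at hB'
  -- Upper rows of the transformed matrix have coefficients at most `4` in the old upper rows.
  have hPY : ∀ i j, |(P.map (Int.cast : ℤ → ℝ) + Q.map (Int.cast : ℤ → ℝ) * Y) i j| ≤ 4 := by
    intro i j
    have := abs_mul_le_of_near_scalar (hnearB B hB) (b := 2 * δ)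
      (q := (P.map (Int.cast : ℤ → ℝ) + Q.map (Int.cast : ℤ → ℝ) * Y) i) (fun k => ?_) j
    · nlinarith
    · have h1 := hB' i (Sum.inl k)
      rw [fromCols_apply_inl, fromCols_apply_inl] at h1
      have h2 : |δ * (1 : Matrix m m ℝ) i k| ≤ δ := by
        rw [Matrix.one_apply]
        split_ifs <;> simp [abs_of_pos hδ, hδ.le]
      have h3 := abs_sub_abs_le_abs_sub (((P.map (Int.cast : ℤ → ℝ) + Q.map (Int.cast : ℤ → ℝ) * Y)
        * B.toCols₁) i k) (δ * (1 : Matrix m m ℝ) i k)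
      have h4 : δ * ε ≤ δ := by nlinarith
      exact (by linarith : |((P.map (Int.cast : ℤ → ℝ) + Q.map (Int.cast : ℤ → ℝ) * Y)
        * B.toCols₁) i k| ≤ 2 * δ)
  -- The new upper rows have no component along the other basis vectors: a nonzero row of `Q * N` has
  -- an entry of size at least `1 / 4`, and the diagonal block of the frame does not shrink it, as
  -- `|det B₁| ≤ 1`.
  have hQ : Q = 0 := by
    refine eq_zero_of_near_scalar (hnearN N hN) Q (b := 2 * δ) (by linarith) fun i j => ?_
    have h1 := hB' i (Sum.inr j)
    rw [fromCols_apply_inr, fromCols_apply_inr, Matrix.zero_apply, mul_zero, sub_zero,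
      Matrix.add_apply, mul_diagonal] at h1
    have h2 : |((P.map (Int.cast : ℤ → ℝ) + Q.map (Int.cast : ℤ → ℝ) * Y) * B.toCols₂) i j| ≤ δ := by
      rw [Matrix.mul_apply]
      calc _ ≤ ∑ k, |(P.map (Int.cast : ℤ → ℝ) + Q.map (Int.cast : ℤ → ℝ) * Y) i k *
            B.toCols₂ k j| := Finset.abs_sum_le_sum_abs _ _
        _ ≤ ∑ _k : m, 4 * (δ * ε) := Finset.sum_le_sum fun k _ => by
            rw [abs_mul]
            refine mul_le_mul (hPY i k) ?_ (abs_nonneg _) (by norm_num)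
            simpa using hB k (Sum.inr j)
        _ = Fintype.card m * ε * (4 * δ) := by
            rw [Finset.sum_const, Finset.card_univ, nsmul_eq_mul]
            ring
        _ ≤ δ := by nlinarith
    set x := (Q.map (Int.cast : ℤ → ℝ) * N) i j
    set D := Function.update (1 : n → ℝ) n₀ B.toCols₁.det⁻¹ j with hD
    have hD1 : 1 ≤ |D| := by
      rw [hD, Function.update_apply]
      split_ifs
      · rw [abs_inv]
        exact (one_le_inv₀ (abs_pos.2 h0)).2 (hδdet B hB)
      · simp
    have h3 : |x * D| ≤ 2 * δ := by
      have := abs_sub_abs_le_abs_sub (x * D)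
        (-((P.map (Int.cast : ℤ → ℝ) + Q.map (Int.cast : ℤ → ℝ) * Y) * B.toCols₂) i j)
      rw [abs_neg, sub_neg_eq_add, add_comm (x * D)] at this
      nlinarith
    rw [abs_mul] at h3
    exact (le_mul_of_one_le_right (abs_nonneg x) hD1).trans h3
  subst hQ
  simp only [Matrix.map_zero _ Int.cast_zero, Matrix.zero_mul, add_zero] at hB' hY' hN'
  have hP : P = 1 := by
    rw [← sub_eq_zero]
    refine eq_zero_of_near_scalar (hnearB B hB) (P - 1) (b := 2 * (δ * ε)) (by nlinarith)
      fun i j => ?_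
    have h1 := hB' i (Sum.inl j)
    have h2 := hB i (Sum.inl j)
    rw [fromCols_apply_inl] at h1 h2
    rw [fromCols_apply_inl] at h1
    have h3 : ((P - 1).map (Int.cast : ℤ → ℝ) * B.toCols₁) i j =
        (P.map (Int.cast : ℤ → ℝ) * B.toCols₁) i j - B i (Sum.inl j) := by
      rw [Matrix.map_sub _ Int.cast_sub, Matrix.sub_mul, Matrix.sub_apply,
        Matrix.map_one _ Int.cast_zero Int.cast_one, Matrix.one_mul, toCols₁_apply]
    rw [h3]
    rw [abs_le] at h1 h2 ⊢
    constructor <;> linarith [h1.1, h1.2, h2.1, h2.2]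
  subst hP
  rw [Matrix.map_one _ Int.cast_zero Int.cast_one, frameCoord_fromBlocks_mul_frame n₀ h0] at hY' hN'
  rw [toCols₁_fromCols] at hY'
  rw [toCols₂_fromCols] at hN'
  have hS : S = 1 := by
    rw [← sub_eq_zero]
    refine eq_zero_of_near_scalar (hnearN N hN) (S - 1) (b := 2 * ε) (by linarith) fun i j => ?_
    have h1 := hU _ hN' i j
    have h2 := hU _ hN i j
    rw [Matrix.map_sub _ Int.cast_sub, Matrix.sub_mul, Matrix.sub_apply,
      Matrix.map_one _ Int.cast_zero Int.cast_one, Matrix.one_mul]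
    rw [abs_le] at h1 h2 ⊢
    constructor <;> linarith [h1.1, h1.2, h2.1, h2.2]
  subst hS
  have hR : R = 0 := by
    ext i j
    have h1 := hY' i j
    have h2 := hY i j
    rw [Matrix.map_one _ Int.cast_zero Int.cast_one, Matrix.one_mul, Matrix.add_apply,
      map_apply] at h1
    have h3 : |(R i j : ℝ)| < 1 := abs_lt.2 ⟨by linarith [h1.1, h2.2], by linarith [h1.2, h2.1]⟩
    have h4 : |R i j| < 1 := by exact_mod_cast h3
    simpa using Int.abs_lt_one_iff.1 h4
  rw [hR, fromBlocks_one]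

/-- The sets of the lower bound. The bound `η` for the determinant controls the normalization to
determinant `1`. -/
theorem exists_set_injective_mod_integral [Nonempty m] (n₀ : n) :
    ∃ K : ENNReal, K ≠ 0 ∧ K ≠ ⊤ ∧ ∃ η > (0 : ℝ), ∃ δ₁ > (0 : ℝ), ∀ δ : ℝ, 0 < δ → δ < δ₁ →
      ∃ S : Set (Matrix (m ⊕ n) (m ⊕ n) ℝ), MeasurableSet S ∧
        volume S = ENNReal.ofReal (δ ^ (Fintype.card m * Fintype.card (m ⊕ n))) * K ∧
        (∀ A ∈ S, A.det ∈ Ioc (0 : ℝ) 1 ∧ η ≤ A.det ∧ ∀ i j, |A (Sum.inl i) j| ≤ 2 * δ) ∧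
        ∀ A ∈ S, ∀ γ : Matrix (m ⊕ n) (m ⊕ n) ℤ, γ.map (Int.cast : ℤ → ℝ) * A ∈ S → γ = 1 := by
  have : Nonempty n := ⟨n₀⟩
  have hm : (1 : ℝ) ≤ Fintype.card m := by exact_mod_cast Fintype.card_pos
  have hn : (1 : ℝ) ≤ Fintype.card n := by exact_mod_cast Fintype.card_pos
  set ε : ℝ := 1 / (8 * (Fintype.card m + Fintype.card n)) with hε
  have hε0 : 0 < ε := by positivity
  have hε1 : ε ≤ 1 := by
    rw [hε, div_le_one (by positivity)]
    linarith
  set η : ℝ := (1 / 2) ^ (Fintype.card n + 1) with hη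
  have hη0 : 0 < η := by positivity
  set U : Set (Matrix n n ℝ) := {N | ∀ i j, |N i j - 1 / 2 * (1 : Matrix n n ℝ) i j| < ε} ∩
    {N | N.det ∈ Ioo η 1} with hU
  have hUo : IsOpen U := by
    refine IsOpen.inter ?_ (isOpen_Ioo.preimage (continuous_id.matrix_det))
    simp only [ofPred_forall]
    refine isOpen_iInter_of_finite fun i => isOpen_iInter_of_finite fun j => ?_
    exact isOpen_lt ((continuous_id.matrix_elem i j).sub continuous_const).abs continuous_const
  have hUne : U.Nonempty := by
    refine ⟨(1 / 2 : ℝ) • 1, fun i j => ?_, ?_⟩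
    · simpa using hε0
    · have hd : ((1 / 2 : ℝ) • (1 : Matrix n n ℝ)).det = (1 / 2) ^ Fintype.card n := by
        rw [det_smul, det_one, mul_one]
      change ((1 / 2 : ℝ) • (1 : Matrix n n ℝ)).det ∈ Ioo η 1
      rw [hd]
      exact ⟨pow_lt_pow_right_of_lt_one₀ (by norm_num) (by norm_num) (by omega),
        pow_lt_one₀ (by norm_num) (by norm_num) Fintype.card_ne_zero⟩
  have hUfin : volume U ≠ ⊤ := by
    refine ((measure_mono fun N hN => ?_).trans_lt ((volume_forall_abs_le (ι := n) (κ := n)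
      zero_le_two).trans_lt ENNReal.ofReal_lt_top)).ne
    intro i j
    have h1 := (hN.1 i j).le
    have h2 : |1 / 2 * (1 : Matrix n n ℝ) i j| ≤ 1 := by
      rw [Matrix.one_apply]
      split_ifs <;> norm_num [abs_le]
    rw [abs_le] at h1 h2 ⊢
    constructor <;> linarith [h1.1, h1.2, h2.1, h2.2]
  obtain ⟨M, hM⟩ : ∃ M : ℝ, M = ((Nat.factorial (Fintype.card m) : ℕ) : ℝ) := ⟨_, rfl⟩
  have hM1 : 1 ≤ M := by
    rw [hM]
    exact_mod_cast Nat.factorial_pos (Fintype.card m)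
  refine ⟨ENNReal.ofReal ((2 * ε) ^ (Fintype.card m * Fintype.card (m ⊕ n))) * volume U,
    mul_ne_zero (by positivity) (hUo.measure_ne_zero _ hUne),
    ENNReal.mul_ne_top ENNReal.ofReal_ne_top hUfin, η, hη0, 1 / (16 * M), by positivity,
    fun δ hδ hδ₁ => ?_⟩
  rw [lt_div_iff₀ (by positivity)] at hδ₁
  have hδ16 : δ < 1 / 16 := by nlinarith
  have hentry : ∀ B ∈ nearScaledId m n ε δ, ∀ i j, |B i j| ≤ 2 * δ := by
    intro B hB i j
    have h1 := hB i j
    have h2 : |δ * (fromCols 1 0 : Matrix m (m ⊕ n) ℝ) i j| ≤ δ := by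
      rcases j with j | j
      · rw [fromCols_apply_inl, Matrix.one_apply]
        split_ifs <;> simp [abs_of_pos hδ, hδ.le]
      · simp [hδ.le]
    have h3 : δ * ε ≤ δ := mul_le_of_le_one_right hδ.le hε1
    rw [abs_le] at h1 h2 ⊢
    constructor <;> linarith [h1.1, h1.2, h2.1, h2.2]
  have hdet : ∀ B ∈ nearScaledId m n ε δ, |B.toCols₁.det| ≤ 1 := by
    intro B hB
    have h1 := Matrix.det_le (A := B.toCols₁) (abv := AbsoluteValue.abs) (x := 2 * δ)
      fun i j => hentry B hB i (Sum.inl j)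
    refine h1.trans ?_
    rw [nsmul_eq_mul, ← hM]
    have h2 : (2 * δ) ^ Fintype.card m ≤ 2 * δ :=
      pow_le_of_le_one (by linarith) (by linarith) Fintype.card_ne_zero
    calc M * (2 * δ) ^ Fintype.card m ≤ M * (2 * δ) := by gcongr
      _ ≤ 1 := by linarith
  have hne : ∀ B ∈ nearScaledId m n ε δ, B.toCols₁.det ≠ 0 := by
    intro B hB
    refine det_ne_zero_of_near_scalar hδ fun i j => (hB i (Sum.inl j)).trans ?_
    rw [le_div_iff₀ (by positivity), mul_assoc]
    refine mul_le_of_le_one_right hδ.le ?_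
    rw [hε, one_div_mul_eq_div, div_le_one (by positivity)]
    linarith
  refine ⟨framedSet n₀ (nearScaledId m n ε δ) U, measurableSet_framedSet n₀
    (measurableSet_nearScaledId ε δ) hUo.measurableSet, ?_, fun A hA => ?_, fun A hA γ hγ => ?_⟩
  · rw [volume_framedSet n₀ (measurableSet_nearScaledId ε δ) hUo.measurableSet hne,
      volume_nearScaledId hε0.le hδ.le, mul_assoc]
  · have hd := hA.2.2.2
    change (frameCoord n₀ A).toCols₂.det ∈ Ioo η 1 at hd
    rw [← det_eq_det_frameCoord n₀ (hne _ hA.1)] at hd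
    exact ⟨⟨hη0.trans hd.1, hd.2.le⟩, hd.1.le, fun i j => hentry _ hA.1 i j⟩
  · exact eq_one_of_mul_mem_framedSet n₀ hε hδ hδ16 hdet (fun N hN i j => (hN.1 i j).le) hA γ hγ

end

/-! ### Comparison with a fundamental domain -/

/-- `F` contains exactly one point of every orbit of `SL(κ, ℤ)` on the matrices with determinant
in `(0, 1]`. -/
structure IsLatticeFundamentalDomain {κ : Type*} [Fintype κ] [DecidableEq κ]
    (F : Set (Matrix κ κ ℝ)) : Prop where
  measurableSet : MeasurableSet F
  det_mem : ∀ A ∈ F, A.det ∈ Ioc (0 : ℝ) 1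
  existsUnique : ∀ A : Matrix κ κ ℝ, A.det ∈ Ioc (0 : ℝ) 1 →
    ∃! γ : {γ : Matrix κ κ ℤ // γ.det = 1}, γ.1.map (Int.cast : ℤ → ℝ) * A ∈ F

section
variable {κ : Type*} [Fintype κ] [DecidableEq κ]

instance countable_int_matrix_det_eq_one : Countable {γ : Matrix κ κ ℤ // γ.det = 1} :=
  have : Countable (Matrix κ κ ℤ) := inferInstanceAs (Countable (κ → κ → ℤ))
  inferInstance

theorem map_adjugate_mul_cancel {γ : Matrix κ κ ℤ} (hγ : γ.det = 1) (A : Matrix κ κ ℝ) :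
    γ.adjugate.map (Int.cast : ℤ → ℝ) * (γ.map (Int.cast : ℤ → ℝ) * A) = A := by
  rw [← Matrix.mul_assoc, ← map_intCast_mul, adjugate_mul, hγ, one_smul,
    Matrix.map_one _ Int.cast_zero Int.cast_one, Matrix.one_mul]

theorem map_mul_adjugate_cancel {γ : Matrix κ κ ℤ} (hγ : γ.det = 1) (A : Matrix κ κ ℝ) :
    γ.map (Int.cast : ℤ → ℝ) * (γ.adjugate.map (Int.cast : ℤ → ℝ) * A) = A := by
  rw [← Matrix.mul_assoc, ← map_intCast_mul, mul_adjugate, hγ, one_smul,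
    Matrix.map_one _ Int.cast_zero Int.cast_one, Matrix.one_mul]

theorem eq_of_adjugate_mul_eq_one {γ δ : Matrix κ κ ℤ} (hδ : δ.det = 1) (h : δ.adjugate * γ = 1) :
    γ = δ := by
  rw [← Matrix.one_mul γ, ← one_smul ℤ (1 : Matrix κ κ ℤ), ← hδ, ← mul_adjugate, Matrix.mul_assoc,
    h, Matrix.mul_one]

theorem measurePreserving_map_intCast_mul {γ : Matrix κ κ ℤ} (hγ : γ.det = 1) :
    MeasurePreserving (fun A : Matrix κ κ ℝ => γ.map (Int.cast : ℤ → ℝ) * A) :=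
  measurePreserving_matrix_mul_left _ (by rw [det_map_intCast, hγ, Int.cast_one])

theorem volume_inter_preimage_mul {γ : Matrix κ κ ℤ} (hγ : γ.det = 1) {S T : Set (Matrix κ κ ℝ)}
    (hS : MeasurableSet S) (hT : MeasurableSet T) :
    volume (S ∩ (fun A => γ.map (Int.cast : ℤ → ℝ) * A) ⁻¹' T) =
      volume ((fun A => γ.adjugate.map (Int.cast : ℤ → ℝ) * A) ⁻¹' S ∩ T) := by
  have hγ' : γ.adjugate.det = 1 := by rw [det_adjugate, hγ, one_pow]
  rw [← (measurePreserving_map_intCast_mul hγ).measure_preimage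
    (((measurePreserving_map_intCast_mul hγ').measurable hS).inter hT).nullMeasurableSet]
  congr 1
  ext A
  simp [map_adjugate_mul_cancel hγ]

/-- If every lattice from `X` has a basis in `S`, then the lattices from `X` have measure at most
`volume S`: move the pieces of the fundamental domain into `S`, where they are disjoint. -/
theorem IsLatticeFundamentalDomain.volume_inter_le {F : Set (Matrix κ κ ℝ)}
    (hF : IsLatticeFundamentalDomain F) {S X : Set (Matrix κ κ ℝ)} (hS : MeasurableSet S)
    (h : ∀ A ∈ F ∩ X, ∃ γ : Matrix κ κ ℤ, γ.det = 1 ∧ γ.map (Int.cast : ℤ → ℝ) * A ∈ S) :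
    volume (F ∩ X) ≤ volume S := by
  have hdet : ∀ γ : {γ : Matrix κ κ ℤ // γ.det = 1}, γ.1.adjugate.det = 1 := fun γ => by
    rw [det_adjugate, γ.2, one_pow]
  calc volume (F ∩ X)
      ≤ volume (⋃ γ : {γ : Matrix κ κ ℤ // γ.det = 1},
          F ∩ (fun A => γ.1.map (Int.cast : ℤ → ℝ) * A) ⁻¹' S) := by
        refine measure_mono fun A hA => ?_
        obtain ⟨γ, hγ, hγS⟩ := h A hA
        exact mem_iUnion.2 ⟨⟨γ, hγ⟩, hA.1, hγS⟩
    _ ≤ ∑' γ : {γ : Matrix κ κ ℤ // γ.det = 1},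
          volume (F ∩ (fun A => γ.1.map (Int.cast : ℤ → ℝ) * A) ⁻¹' S) := measure_iUnion_le _
    _ = ∑' γ : {γ : Matrix κ κ ℤ // γ.det = 1},
          volume ((fun A => γ.1.adjugate.map (Int.cast : ℤ → ℝ) * A) ⁻¹' F ∩ S) :=
        tsum_congr fun γ => volume_inter_preimage_mul γ.2 hF.measurableSet hS
    _ = volume (⋃ γ : {γ : Matrix κ κ ℤ // γ.det = 1},
          (fun A => γ.1.adjugate.map (Int.cast : ℤ → ℝ) * A) ⁻¹' F ∩ S) := by
        refine (measure_iUnion (fun γ δ hγδ => disjoint_left.2 ?_) fun γ => ?_).symm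
        · rintro A ⟨hA, -⟩ ⟨hA', -⟩
          have hAdet : A.det ∈ Ioc (0 : ℝ) 1 := by
            have := hF.det_mem _ hA
            rwa [det_mul, det_map_intCast, hdet γ, Int.cast_one, one_mul] at this
          have : γ.1.adjugate = δ.1.adjugate := Subtype.ext_iff.1
            ((hF.existsUnique A hAdet).unique (y₁ := ⟨_, hdet γ⟩) (y₂ := ⟨_, hdet δ⟩) hA hA')
          refine hγδ (Subtype.ext (eq_of_adjugate_mul_eq_one δ.2 ?_))
          rw [← this, adjugate_mul, γ.2, one_smul]
        · exact ((measurePreserving_map_intCast_mul (hdet γ)).measurable hF.measurableSet).inter hS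
    _ ≤ volume S := measure_mono (iUnion_subset fun γ => inter_subset_right)

/-- If different elements of `S` are bases of different lattices, all of them in `X`, then the lattices
from `X` have measure at least `volume S`: move the pieces of `S` into the fundamental domain, where
they are disjoint. -/
theorem IsLatticeFundamentalDomain.le_volume_inter {F : Set (Matrix κ κ ℝ)}
    (hF : IsLatticeFundamentalDomain F) {S X : Set (Matrix κ κ ℝ)} (hS : MeasurableSet S)
    (hSdet : ∀ A ∈ S, A.det ∈ Ioc (0 : ℝ) 1)
    (hSX : ∀ A ∈ S, ∀ γ : Matrix κ κ ℤ, γ.det = 1 → γ.map (Int.cast : ℤ → ℝ) * A ∈ X)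
    (hinj : ∀ A ∈ S, ∀ γ : Matrix κ κ ℤ, γ.map (Int.cast : ℤ → ℝ) * A ∈ S → γ = 1) :
    volume S ≤ volume (F ∩ X) := by
  have hdet : ∀ γ : {γ : Matrix κ κ ℤ // γ.det = 1}, γ.1.adjugate.det = 1 := fun γ => by
    rw [det_adjugate, γ.2, one_pow]
  calc volume S
      ≤ volume (⋃ γ : {γ : Matrix κ κ ℤ // γ.det = 1},
          S ∩ (fun A => γ.1.map (Int.cast : ℤ → ℝ) * A) ⁻¹' F) := by
        refine measure_mono fun A hA => ?_
        obtain ⟨γ, hγ, -⟩ := hF.existsUnique A (hSdet A hA)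
        exact mem_iUnion.2 ⟨γ, hA, hγ⟩
    _ ≤ ∑' γ : {γ : Matrix κ κ ℤ // γ.det = 1},
          volume (S ∩ (fun A => γ.1.map (Int.cast : ℤ → ℝ) * A) ⁻¹' F) := measure_iUnion_le _
    _ = ∑' γ : {γ : Matrix κ κ ℤ // γ.det = 1},
          volume ((fun A => γ.1.adjugate.map (Int.cast : ℤ → ℝ) * A) ⁻¹' S ∩ F) :=
        tsum_congr fun γ => volume_inter_preimage_mul γ.2 hS hF.measurableSet
    _ = volume (⋃ γ : {γ : Matrix κ κ ℤ // γ.det = 1},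
          (fun A => γ.1.adjugate.map (Int.cast : ℤ → ℝ) * A) ⁻¹' S ∩ F) := by
        refine (measure_iUnion (fun γ δ hγδ => disjoint_left.2 ?_) fun γ => ?_).symm
        · rintro A ⟨hA, -⟩ ⟨hA', -⟩
          refine hγδ (Subtype.ext (eq_of_adjugate_mul_eq_one δ.2 (hinj _ hA _ ?_)))
          rwa [map_intCast_mul, Matrix.mul_assoc, map_mul_adjugate_cancel γ.2]
        · exact ((measurePreserving_map_intCast_mul (hdet γ)).measurable hS).inter hF.measurableSet
    _ ≤ volume (F ∩ X) := by
        refine measure_mono (iUnion_subset fun γ A hA => ⟨hA.2, ?_⟩)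
        rw [← map_mul_adjugate_cancel γ.2 A]
        exact hSX _ hA.1 _ γ.2

theorem IsLatticeFundamentalDomain.volume_ne_zero {F : Set (Matrix κ κ ℝ)} [Nonempty κ]
    (hF : IsLatticeFundamentalDomain F) : volume F ≠ 0 := by
  intro h0
  have hopen : IsOpen {A : Matrix κ κ ℝ | A.det ∈ Ioo (0 : ℝ) 1} :=
    isOpen_Ioo.preimage continuous_id.matrix_det
  refine hopen.measure_ne_zero volume ⟨(1 / 2 : ℝ) • 1, ?_⟩ ?_
  · rw [mem_ofPred_eq, det_smul, det_one, mul_one]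
    exact ⟨by positivity, pow_lt_one₀ (by norm_num) (by norm_num) Fintype.card_ne_zero⟩
  · refine measure_mono_null (t := ⋃ γ : {γ : Matrix κ κ ℤ // γ.det = 1},
      (fun A => γ.1.map (Int.cast : ℤ → ℝ) * A) ⁻¹' F) (fun A hA => ?_)
      (measure_iUnion_null fun γ => ?_)
    · obtain ⟨γ, hγ, -⟩ := hF.existsUnique A ⟨hA.1, hA.2.le⟩
      exact mem_iUnion.2 ⟨γ, hγ⟩
    · rwa [(measurePreserving_map_intCast_mul γ.2).measure_preimage
        hF.measurableSet.nullMeasurableSet]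

end

/-! ### Successive minima of column lattices -/

theorem mem_columnLattice_iff {d : ℕ} (g : SLR d) (v : EuclideanSpace ℝ (Fin d)) :
    v ∈ columnLattice g ↔
      ∃ z : Fin d → ℤ, WithLp.toLp 2 (g.1 *ᵥ fun l => (z l : ℝ)) = v := by
  rw [columnLattice, Submodule.mem_span_range_iff_exists_fun]
  refine exists_congr fun z => ?_
  have : ∑ j, z j • (WithLp.toLp 2 fun i : Fin d => g i j : EuclideanSpace ℝ (Fin d)) =
      WithLp.toLp 2 (g.1 *ᵥ fun l => (z l : ℝ)) := by
    ext i
    simp [mulVec, dotProduct, mul_comm]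
  rw [this]

theorem linearIndependent_toLp_mulVec_iff {d i : ℕ} (g : SLR d) (z : Fin i → Fin d → ℝ) :
    LinearIndependent ℝ (fun k => (WithLp.toLp 2 (g.1 *ᵥ z k) : EuclideanSpace ℝ (Fin d))) ↔
      LinearIndependent ℝ z := by
  let f : (Fin d → ℝ) →ₗ[ℝ] EuclideanSpace ℝ (Fin d) :=
    (WithLp.linearEquiv 2 ℝ (Fin d → ℝ)).symm.toLinearMap ∘ₗ toLin' g.1
  have hinj : Function.Injective (g.1 *ᵥ · : (Fin d → ℝ) → Fin d → ℝ) := by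
    refine mulVec_injective_iff_isUnit.2 ((isUnit_iff_isUnit_det _).2 ?_)
    rw [g.2]
    exact isUnit_one
  have hf : f.ker = ⊥ := LinearMap.ker_eq_bot.2 fun x y h =>
    hinj ((WithLp.linearEquiv 2 ℝ (Fin d → ℝ)).symm.injective (by simpa [f] using h))
  exact f.linearIndependent_iff hf (v := z)

/-- The infimum in the definition of the successive minimum is taken over a nonempty set of
nonnegative numbers, so that it is not a junk value; in terms of integral coordinate vectors, the
condition is a countable one. -/
theorem successiveMinimum_columnLattice_le_iff {d i : ℕ} (hi : 1 ≤ i) (hid : i ≤ d) (g : SLR d)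
    (δ : ℝ) : successiveMinimum i (columnLattice g) ≤ δ ↔ ∀ r > δ,
      ∃ z : Fin i → Fin d → ℤ, LinearIndependent ℝ (fun k l => (z k l : ℝ)) ∧
        ∀ k, ‖(WithLp.toLp 2 (g.1 *ᵥ fun l => (z k l : ℝ)) : EuclideanSpace ℝ (Fin d))‖ ≤ r := by
  set T := {r : ℝ | ∃ v : Fin i → EuclideanSpace ℝ (Fin d),
    LinearIndependent ℝ v ∧ ∀ k, v k ∈ columnLattice g ∧ ‖v k‖ ≤ r} with hT
  have hmem : ∀ r, r ∈ T ↔ ∃ z : Fin i → Fin d → ℤ,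
      LinearIndependent ℝ (fun k l => (z k l : ℝ)) ∧
        ∀ k, ‖(WithLp.toLp 2 (g.1 *ᵥ fun l => (z k l : ℝ)) : EuclideanSpace ℝ (Fin d))‖ ≤ r := by
    intro r
    constructor
    · rintro ⟨v, hv, h⟩
      choose z hz using fun k => (mem_columnLattice_iff g (v k)).1 (h k).1
      refine ⟨z, ?_, fun k => by rw [hz]; exact (h k).2⟩
      rw [← linearIndependent_toLp_mulVec_iff g]
      simpa only [hz] using hv
    · rintro ⟨z, hz, h⟩
      exact ⟨_, (linearIndependent_toLp_mulVec_iff g _).2 hz, fun k =>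
        ⟨(mem_columnLattice_iff g _).2 ⟨z k, rfl⟩, h k⟩⟩
  have hbdd : BddBelow T := by
    refine ⟨0, ?_⟩
    rintro r ⟨v, -, h⟩
    exact (norm_nonneg _).trans (h ⟨0, hi⟩).2
  have hne : T.Nonempty := by
    let z : Fin i → Fin d → ℤ := fun k => Pi.single (Fin.castLE hid k) 1
    refine ⟨∑ k, ‖(WithLp.toLp 2 (g.1 *ᵥ fun l => (z k l : ℝ)) : EuclideanSpace ℝ (Fin d))‖,
      (hmem _).2 ⟨z, ?_, fun k => Finset.single_le_sum (f := fun k =>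
        ‖(WithLp.toLp 2 (g.1 *ᵥ fun l => (z k l : ℝ)) : EuclideanSpace ℝ (Fin d))‖)
        (fun _ _ => norm_nonneg _) (Finset.mem_univ k)⟩⟩
    have hz : (fun k l => (z k l : ℝ)) = fun k => Pi.basisFun ℝ (Fin d) (Fin.castLE hid k) := by
      ext k l
      simp [z, Pi.single_apply]
    rw [hz]
    exact (Pi.basisFun ℝ (Fin d)).linearIndependent.comp _ (Fin.castLE_injective hid)
  change sInf T ≤ δ ↔ _
  constructor
  · intro h r hr
    obtain ⟨s, hs, hsr⟩ := exists_lt_of_csInf_lt hne (h.trans_lt hr)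
    obtain ⟨z, hz, hz'⟩ := (hmem s).1 hs
    exact ⟨z, hz, fun k => (hz' k).trans hsr.le⟩
  · exact fun h => le_of_forall_gt_imp_ge_of_dense fun r hr => csInf_le hbdd ((hmem r).2 (h r hr))

theorem measurableSet_successiveMinimum_le {d i : ℕ} (hi : 1 ≤ i) (hid : i ≤ d) (δ : ℝ) :
    MeasurableSet {g : SLR d | successiveMinimum i (columnLattice g) ≤ δ} := by
  have h : {g : SLR d | successiveMinimum i (columnLattice g) ≤ δ} =
      ⋂ n : ℕ, ⋃ z : {z : Fin i → Fin d → ℤ // LinearIndependent ℝ fun k l => (z k l : ℝ)},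
        ⋂ k, {g : SLR d | ‖(WithLp.toLp 2 (g.1 *ᵥ fun l => (z.1 k l : ℝ)) :
          EuclideanSpace ℝ (Fin d))‖ ≤ δ + 1 / (n + 1)} := by
    ext g
    rw [mem_ofPred_eq, successiveMinimum_columnLattice_le_iff hi hid]
    simp only [mem_iInter, mem_iUnion, mem_ofPred_eq, Subtype.exists, exists_prop]
    constructor
    · exact fun h n => h _ (lt_add_of_pos_right δ (by positivity))
    · intro h r hr
      obtain ⟨n, hn⟩ := exists_nat_one_div_lt (sub_pos.2 hr)
      obtain ⟨z, hz, hz'⟩ := h n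
      exact ⟨z, hz, fun k => (hz' k).trans (by linarith)⟩
  rw [h]
  refine MeasurableSet.iInter fun n => MeasurableSet.iUnion fun z => MeasurableSet.iInter fun k => ?_
  refine (isClosed_le ?_ continuous_const).measurableSet
  refine ((PiLp.continuous_toLp 2 _).comp ?_).norm
  exact continuous_subtype_val.matrix_mulVec continuous_const

theorem norm_le_norm_toLp {d : ℕ} (v : Fin d → ℝ) :
    ‖v‖ ≤ ‖(WithLp.toLp 2 v : EuclideanSpace ℝ (Fin d))‖ :=
  (pi_norm_le_iff_of_nonneg (norm_nonneg _)).2 fun i =>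
    PiLp.norm_apply_le (WithLp.toLp 2 v : EuclideanSpace ℝ (Fin d)) i

theorem norm_toLp_le {d : ℕ} (v : Fin d → ℝ) {b : ℝ} (hb : ∀ i, |v i| ≤ b) :
    ‖(WithLp.toLp 2 v : EuclideanSpace ℝ (Fin d))‖ ≤ d * b := by
  have h : (WithLp.toLp 2 v : EuclideanSpace ℝ (Fin d)) =
      ∑ i, v i • EuclideanSpace.single i (1 : ℝ) := by
    ext j
    simp [Pi.single_apply]
  rw [h]
  refine (norm_sum_le _ _).trans ((Finset.sum_le_sum fun i _ => ?_).trans_eq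
    (by rw [Finset.sum_const, Finset.card_univ, Fintype.card_fin, nsmul_eq_mul]))
  rw [norm_smul, PiLp.norm_single]
  simpa using hb i

/-! ### Haar measure as a cone measure -/

theorem det_rpow_smul_transpose {d : ℕ} {A : Matrix (Fin d) (Fin d) ℝ} (hA : 0 < A.det) :
    (A.det ^ (-(1 / d : ℝ)) • Aᵀ).det = 1 := by
  rw [det_smul, det_transpose, Fintype.card_fin]
  rcases Nat.eq_zero_or_pos d with rfl | hd
  · simp
  · rw [← Real.rpow_natCast, ← Real.rpow_mul hA.le, neg_mul, one_div,
      inv_mul_cancel₀ (by exact_mod_cast hd.ne'), Real.rpow_neg_one, inv_mul_cancel₀ hA.ne']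

open scoped Classical in
/-- The element of `SL(d, ℝ)` whose columns are proportional to the rows of `A`. The value at the
matrices with determinant at most `0` is arbitrary. -/
noncomputable def unimodularTranspose {d : ℕ} (A : Matrix (Fin d) (Fin d) ℝ) : SLR d :=
  if h : 0 < A.det then ⟨A.det ^ (-(1 / d : ℝ)) • Aᵀ, det_rpow_smul_transpose h⟩ else 1

theorem unimodularTranspose_val {d : ℕ} {A : Matrix (Fin d) (Fin d) ℝ} (hA : 0 < A.det) :
    (unimodularTranspose A).1 = A.det ^ (-(1 / d : ℝ)) • Aᵀ := by
  have h : unimodularTranspose A = (⟨_, det_rpow_smul_transpose hA⟩ : SLR d) := dif_pos hA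
  rw [h]

theorem unimodularTranspose_mul_right {d : ℕ} {A : Matrix (Fin d) (Fin d) ℝ} (hA : 0 < A.det)
    (g : SLR d) : unimodularTranspose (A * g.1ᵀ) = g * unimodularTranspose A := by
  have hdet : (A * g.1ᵀ).det = A.det := by rw [det_mul, det_transpose, g.2, mul_one]
  refine Subtype.ext ?_
  change _ = g.1 * (unimodularTranspose A).1
  rw [unimodularTranspose_val (by rwa [hdet]), unimodularTranspose_val hA, hdet, transpose_mul,
    transpose_transpose, Matrix.mul_smul]

theorem unimodularTranspose_mul_left {d : ℕ} {A : Matrix (Fin d) (Fin d) ℝ} (hA : 0 < A.det)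
    (g : SLR d) : unimodularTranspose (g.1ᵀ * A) = unimodularTranspose A * g := by
  have hdet : (g.1ᵀ * A).det = A.det := by rw [det_mul, det_transpose, g.2, one_mul]
  refine Subtype.ext ?_
  change _ = (unimodularTranspose A).1 * g.1
  rw [unimodularTranspose_val (by rwa [hdet]), unimodularTranspose_val hA, hdet, transpose_mul,
    transpose_transpose, Matrix.smul_mul]

/-- The element of `SL(d, ℝ)` that belongs to the transpose of a unimodular integral matrix. -/
noncomputable def transposeSLZ {d : ℕ} (γ : Matrix (Fin d) (Fin d) ℤ) (hγ : γ.det = 1) : SLR d :=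
  SpecialLinearGroup.map (n := Fin d) (Int.castRingHom ℝ) ⟨γᵀ, by rwa [det_transpose]⟩

theorem transposeSLZ_mem {d : ℕ} (γ : Matrix (Fin d) (Fin d) ℤ) (hγ : γ.det = 1) :
    transposeSLZ γ hγ ∈ SLZ d := ⟨_, rfl⟩

theorem transpose_transposeSLZ {d : ℕ} (γ : Matrix (Fin d) (Fin d) ℤ) (hγ : γ.det = 1) :
    (transposeSLZ γ hγ).1ᵀ = γ.map (Int.cast : ℤ → ℝ) := rfl

theorem unimodularTranspose_map_mul {d : ℕ} {A : Matrix (Fin d) (Fin d) ℝ} (hA : 0 < A.det)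
    (γ : Matrix (Fin d) (Fin d) ℤ) (hγ : γ.det = 1) :
    unimodularTranspose (γ.map (Int.cast : ℤ → ℝ) * A) =
      unimodularTranspose A * transposeSLZ γ hγ := by
  rw [← unimodularTranspose_mul_left hA, transpose_transposeSLZ]

theorem measurable_unimodularTranspose {d : ℕ} :
    Measurable (unimodularTranspose : Matrix (Fin d) (Fin d) ℝ → SLR d) := by
  classical
  have hdet : Measurable fun A : Matrix (Fin d) (Fin d) ℝ => A.det :=
    continuous_id.matrix_det.measurable
  have h : Measurable fun A : Matrix (Fin d) (Fin d) ℝ =>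
      if 0 < A.det then A.det ^ (-(1 / d : ℝ)) • Aᵀ else 1 := by
    refine Measurable.ite (measurableSet_lt measurable_const hdet) ?_ measurable_const
    exact (hdet.pow_const _).smul continuous_id.matrix_transpose.measurable
  have hval : (fun A : Matrix (Fin d) (Fin d) ℝ => (unimodularTranspose A).1) =
      fun A => if 0 < A.det then A.det ^ (-(1 / d : ℝ)) • Aᵀ else 1 := by
    ext1 A
    by_cases hA : 0 < A.det
    · rw [if_pos hA]
      exact unimodularTranspose_val hA
    · rw [if_neg hA]
      exact congrArg Subtype.val (dif_neg hA : unimodularTranspose A = 1)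
  rw [← hval] at h
  refine measurable_of_isOpen fun O hO => ?_
  obtain ⟨O', hO', rfl⟩ := isOpen_induced_iff.1 hO
  exact h hO'.measurableSet

theorem measurableSet_det_mem_Ioc {d : ℕ} :
    MeasurableSet {A : Matrix (Fin d) (Fin d) ℝ | A.det ∈ Ioc (0 : ℝ) 1} :=
  continuous_id.matrix_det.measurable measurableSet_Ioc

/-- The measure on `SL(d, ℝ)` that assigns to a set the Lebesgue measure of the cone over its
transpose, cut off at determinant `1`. It is a Haar measure. -/
noncomputable def coneMeasure (d : ℕ) : Measure (SLR d) :=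
  (volume.restrict {A : Matrix (Fin d) (Fin d) ℝ | A.det ∈ Ioc (0 : ℝ) 1}).map unimodularTranspose

theorem coneMeasure_apply {d : ℕ} {T : Set (SLR d)} (hT : MeasurableSet T) :
    coneMeasure d T =
      volume {A : Matrix (Fin d) (Fin d) ℝ | A.det ∈ Ioc (0 : ℝ) 1 ∧ unimodularTranspose A ∈ T} := by
  rw [coneMeasure, Measure.map_apply measurable_unimodularTranspose hT,
    Measure.restrict_apply (measurable_unimodularTranspose hT), inter_comm]
  rfl

instance coneMeasure.instIsMulLeftInvariant (d : ℕ) : (coneMeasure d).IsMulLeftInvariant := by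
  refine ⟨fun g => ?_⟩
  have hmul : Measurable fun h : SLR d => g * h := (continuous_const_mul g).measurable
  have hg : g.1ᵀ.det = 1 := by rw [det_transpose, g.2]
  have hpres := (measurePreserving_matrix_mul_right (ι := Fin d) g.1ᵀ hg).restrict_preimage
    (measurableSet_det_mem_Ioc (d := d))
  have hpre : (fun A : Matrix (Fin d) (Fin d) ℝ => A * g.1ᵀ) ⁻¹' {A | A.det ∈ Ioc (0 : ℝ) 1} =
      {A | A.det ∈ Ioc (0 : ℝ) 1} := by
    ext A
    simp only [mem_preimage, mem_ofPred_eq, det_mul, hg, mul_one]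
  rw [hpre] at hpres
  rw [coneMeasure, Measure.map_map hmul measurable_unimodularTranspose]
  conv_rhs => rw [← hpres.map_eq, Measure.map_map measurable_unimodularTranspose hpres.measurable]
  refine Measure.map_congr ?_
  filter_upwards [ae_restrict_mem measurableSet_det_mem_Ioc] with A hA
  exact (unimodularTranspose_mul_right hA.1 g).symm

instance coneMeasure.instIsFiniteMeasureOnCompacts (d : ℕ) :
    IsFiniteMeasureOnCompacts (coneMeasure d) := by
  refine ⟨fun K hK => ?_⟩
  have hbound : ∀ i j, ∃ R : ℝ, ∀ g ∈ K, |g.1 i j| ≤ R := by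
    intro i j
    have hcont : Continuous fun g : SLR d => g.1 i j := continuous_subtype_val.matrix_elem i j
    obtain ⟨R, hR⟩ := hK.exists_bound_of_continuousOn hcont.continuousOn
    exact ⟨R, hR⟩
  choose R hR using hbound
  set M := ∑ i, ∑ j, |R i j| with hM
  have hRM : ∀ i j, R i j ≤ M := fun i j => (le_abs_self _).trans
    ((Finset.single_le_sum (f := fun j => |R i j|) (fun _ _ => abs_nonneg _)
      (Finset.mem_univ j)).trans (Finset.single_le_sum (f := fun i => ∑ j, |R i j|)
      (fun _ _ => Finset.sum_nonneg fun _ _ => abs_nonneg _) (Finset.mem_univ i)))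
  have hM0 : 0 ≤ M := Finset.sum_nonneg fun _ _ => Finset.sum_nonneg fun _ _ => abs_nonneg _
  rw [coneMeasure_apply hK.measurableSet]
  refine (measure_mono fun A hA => ?_).trans_lt ((volume_forall_abs_le (ι := Fin d) (κ := Fin d)
    hM0).trans_lt ENNReal.ofReal_lt_top)
  intro i j
  have hpos : 0 < A.det := hA.1.1
  have h1 : |A.det ^ (-(1 / d : ℝ)) * A i j| ≤ M := by
    have := (hR j i _ hA.2).trans (hRM j i)
    rwa [unimodularTranspose_val hpos] at this
  have h2 : 1 ≤ A.det ^ (-(1 / d : ℝ)) :=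
    Real.one_le_rpow_of_pos_of_le_one_of_nonpos hpos hA.1.2 (by simp)
  rw [abs_mul, abs_of_pos (by linarith)] at h1
  exact (le_mul_of_one_le_left (abs_nonneg _) h2).trans h1

/-- The fundamental domain of `SL(d, ℤ)` in `SL(d, ℝ)`, transferred to the matrices with determinant
in `(0, 1]`. -/
def coneFundamentalDomain (d : ℕ) : Set (Matrix (Fin d) (Fin d) ℝ) :=
  {A | A.det ∈ Ioc (0 : ℝ) 1 ∧ unimodularTranspose A ∈ fundamentalDomainSLZ d}

theorem isLatticeFundamentalDomain_coneFundamentalDomain (d : ℕ) :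
    IsLatticeFundamentalDomain (coneFundamentalDomain d) where
  measurableSet := measurableSet_det_mem_Ioc.inter
    (measurable_unimodularTranspose (fundamentalDomainSLZ_spec d).1)
  det_mem A hA := hA.1
  existsUnique A hA := by
    obtain ⟨⟨γ, hγ⟩, hγF, huniq⟩ := (fundamentalDomainSLZ_spec d).2 (unimodularTranspose A)
    have hdet : ∀ δ : {γ : Matrix (Fin d) (Fin d) ℤ // γ.det = 1},
        (δ.1.map (Int.cast : ℤ → ℝ) * A).det = A.det := fun δ => by
      rw [det_mul, det_map_intCast, δ.2, Int.cast_one, one_mul]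
    obtain ⟨c, hc⟩ := id hγ
    have hγc : γ = transposeSLZ c.1ᵀ (by rw [det_transpose]; exact c.2) := hc.symm
    refine ⟨⟨c.1ᵀ, by rw [det_transpose]; exact c.2⟩, ⟨by rwa [hdet], ?_⟩, ?_⟩
    · rw [unimodularTranspose_map_mul hA.1 _ (by rw [det_transpose]; exact c.2), ← hγc]
      exact hγF
    · rintro ⟨δ, hδ⟩ ⟨-, h⟩
      rw [unimodularTranspose_map_mul hA.1 _ hδ] at h
      have h1 := huniq ⟨transposeSLZ δ hδ, transposeSLZ_mem δ hδ⟩ h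
      have h2 : transposeSLZ δ hδ = γ := congrArg Subtype.val h1
      have h3 : δ.map (Int.cast : ℤ → ℝ) = c.1ᵀ.map (Int.cast : ℤ → ℝ) := by
        rw [← transpose_transposeSLZ δ hδ, h2, hγc, transpose_transposeSLZ]
      exact Subtype.ext (Matrix.map_injective Int.cast_injective h3)

/-- The passage from Haar measure to Lebesgue measure, by the uniqueness of Haar measure. -/
theorem minimaDistribution_eq {d i : ℕ} (hi : 1 ≤ i) (hid : i ≤ d) (δ : ℝ) :
    minimaDistribution d i δ = ((volume (coneFundamentalDomain d))⁻¹ *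
      volume (coneFundamentalDomain d ∩
        {A | successiveMinimum i (columnLattice (unimodularTranspose A)) ≤ δ})).toReal := by
  have : NeZero d := ⟨by omega⟩
  have hF := (fundamentalDomainSLZ_spec d).1
  set T := {g : SLR d | successiveMinimum i (columnLattice g) ≤ δ} with hT
  have hTm : MeasurableSet T := measurableSet_successiveMinimum_le hi hid δ
  have hSm : MeasurableSet {x : UnimodularLattices d | successiveMinimum i x.lattice ≤ δ} :=
    measurableSet_quotient.2 hTm
  obtain ⟨c, hc⟩ : ∃ c : NNReal, coneMeasure d = c • (Measure.haar : Measure (SLR d)) :=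
    ⟨_, Measure.isMulLeftInvariant_eq_smul _ _⟩
  have hcF : volume (coneFundamentalDomain d) = c * Measure.haar (fundamentalDomainSLZ d) := by
    rw [coneFundamentalDomain, ← coneMeasure_apply hF, hc]
    rfl
  have hcFT : volume (coneFundamentalDomain d ∩
      {A | successiveMinimum i (columnLattice (unimodularTranspose A)) ≤ δ}) =
      c * Measure.haar (fundamentalDomainSLZ d ∩ T) := by
    have h1 := coneMeasure_apply (hF.inter hTm)
    rw [hc] at h1
    refine Eq.trans ?_ h1.symm
    congr 1
    ext A
    exact and_assoc
  have hc0 : (c : ENNReal) ≠ 0 := by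
    have : Nonempty (Fin d) := ⟨⟨0, by omega⟩⟩
    intro h
    apply (isLatticeFundamentalDomain_coneFundamentalDomain d).volume_ne_zero
    rw [hcF, h, zero_mul]
  rw [minimaDistribution, measureReal_def, haarProbability,
    Measure.map_apply QuotientGroup.measurable_coe hSm, ProbabilityTheory.cond_apply hF, hcF, hcFT,
    ENNReal.mul_inv (Or.inl hc0) (Or.inl ENNReal.coe_ne_top)]
  congr 1
  rw [mul_mul_mul_comm, ENNReal.inv_mul_cancel hc0 ENNReal.coe_ne_top, one_mul]
  rfl

/-! ### Bounds for the distribution of the successive minima -/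

theorem unimodularTranspose_mulVec {d : ℕ} {A : Matrix (Fin d) (Fin d) ℝ} (hA : 0 < A.det)
    (v : Fin d → ℝ) : (unimodularTranspose A).1 *ᵥ v = A.det ^ (-(1 / d : ℝ)) • (v ᵥ* A) := by
  rw [unimodularTranspose_val hA, smul_mulVec, mulVec_transpose]

/-- The passage from the lattice of `A` to its normalization to determinant `1` makes vectors longer,
as `det A ≤ 1`. -/
theorem exists_integer_vecMul_le {d i : ℕ} (hi : 1 ≤ i) (hid : i ≤ d)
    {A : Matrix (Fin d) (Fin d) ℝ} (hA : A.det ∈ Ioc (0 : ℝ) 1) {δ : ℝ} (hδ : 0 < δ)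
    (h : successiveMinimum i (columnLattice (unimodularTranspose A)) ≤ δ) :
    ∃ z : Fin i → Fin d → ℤ, LinearIndependent ℝ (fun k l => (z k l : ℝ)) ∧
      ∀ k, ‖(fun l => (z k l : ℝ)) ᵥ* A‖ ≤ 2 * δ := by
  obtain ⟨z, hz, hz'⟩ := (successiveMinimum_columnLattice_le_iff hi hid _ δ).1 h (2 * δ)
    (by linarith)
  refine ⟨z, hz, fun k => ?_⟩
  have h1 := (norm_le_norm_toLp _).trans (hz' k)
  rw [unimodularTranspose_mulVec hA.1, norm_smul, Real.norm_eq_abs,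
    abs_of_pos (Real.rpow_pos_of_pos hA.1 _)] at h1
  exact (le_mul_of_one_le_left (norm_nonneg _)
    (Real.one_le_rpow_of_pos_of_le_one_of_nonpos hA.1 hA.2 (by simp))).trans h1

theorem successiveMinimum_le_of_rows_le {d i : ℕ} (hi : 1 ≤ i) (hid : i ≤ d)
    {A : Matrix (Fin d) (Fin d) ℝ} {η : ℝ} (hη : 0 < η) (hA : η ≤ A.det) (f : Fin i → Fin d)
    (hf : Function.Injective f) {b : ℝ} (hb : ∀ k l, |A (f k) l| ≤ b) :
    successiveMinimum i (columnLattice (unimodularTranspose A)) ≤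
      d * (η ^ (-(1 / d : ℝ)) * b) := by
  rw [successiveMinimum_columnLattice_le_iff hi hid]
  intro r hr
  refine ⟨fun k => Pi.single (f k) 1, ?_, fun k => ?_⟩
  · have hz : (fun k l => ((Pi.single (f k) 1 : Fin d → ℤ) l : ℝ)) =
        fun k => Pi.basisFun ℝ (Fin d) (f k) := by
      ext k l
      simp [Pi.single_apply]
    rw [hz]
    exact (Pi.basisFun ℝ (Fin d)).linearIndependent.comp _ hf
  · refine le_trans (norm_toLp_le _ fun l => ?_) hr.le
    have hrow : (fun l => ((Pi.single (f k) 1 : Fin d → ℤ) l : ℝ)) ᵥ* A = A (f k) := by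
      have : (fun l => ((Pi.single (f k) 1 : Fin d → ℤ) l : ℝ)) = Pi.single (f k) 1 := by
        ext l
        simp [Pi.single_apply]
      rw [this, single_one_vecMul]
      rfl
    have hpos : 0 < A.det := hη.trans_le hA
    rw [unimodularTranspose_mulVec hpos, hrow, Pi.smul_apply, smul_eq_mul, abs_mul,
      abs_of_pos (Real.rpow_pos_of_pos hpos _)]
    exact mul_le_mul (Real.rpow_le_rpow_of_nonpos hη hA (by simp)) (hb k l) (abs_nonneg _)
      (Real.rpow_nonneg hη.le _)

theorem exists_minimaDistribution_le {i n : ℕ} (hi : 1 ≤ i) :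
    ∃ C > (0 : ℝ), ∀ δ : ℝ, 0 < δ →
      minimaDistribution (i + (n + 1)) i δ ≤ C * δ ^ ((i + (n + 1)) * i) := by
  set d := i + (n + 1) with hd
  have : Nonempty (Fin d) := ⟨⟨0, by omega⟩⟩
  have hid : i ≤ d := by omega
  have hF := isLatticeFundamentalDomain_coneFundamentalDomain d
  have hV0 := hF.volume_ne_zero
  obtain ⟨U, hUm, hUv, hU⟩ := exists_coversLattices_volume_lt_top n
  set V := volume (coneFundamentalDomain d)
  let e : Fin i ⊕ Fin (n + 1) ≃ Fin d := finSumFinEquiv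
  refine ⟨(V⁻¹ * volume U).toReal * (2 * (2 ^ i * 2)) ^ (d * i) + 1, by positivity, fun δ hδ => ?_⟩
  obtain ⟨S, hSm, hSv, hS⟩ := exists_cover_of_short_vectors hi (0 : Fin (n + 1)) hUm hU
    (r := 2 * δ) (by positivity)
  have he := measurePreserving_submatrix e.symm
  have hle := hF.volume_inter_le
    (X := {A | successiveMinimum i (columnLattice (unimodularTranspose A)) ≤ δ})
    (he.measurable hSm) fun A hA => by
      refine exists_map_mul_mem_preimage_submatrix e
        (hS _ (by rw [det_submatrix_equiv_self]; exact hA.1.1) ?_)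
      obtain ⟨z, hz, hzle⟩ := exists_integer_vecMul_le hi hid hA.1.1 hδ hA.2
      refine ⟨fun k l => z k (e l), ?_, fun k => ?_⟩
      · exact hz.map' (LinearMap.funLeft ℝ ℝ e)
          (LinearMap.ker_eq_bot.2 (LinearMap.funLeft_injective_of_surjective ℝ ℝ _ e.surjective))
      · have h1 : (fun l => (z k (e l) : ℝ)) ᵥ* A.submatrix e e =
            ((fun l => (z k l : ℝ)) ᵥ* A) ∘ e := by
          ext l
          exact Equiv.sum_comp e fun j => (z k j : ℝ) * A j (e l)
        rw [h1]
        refine (pi_norm_le_iff_of_nonneg (by positivity)).2 fun l => ?_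
        exact (norm_le_pi_norm ((fun l => (z k l : ℝ)) ᵥ* A) (e l)).trans (hzle k)
  rw [he.measure_preimage hSm.nullMeasurableSet] at hle
  rw [minimaDistribution_eq hi hid]
  have hfin : V⁻¹ * (ENNReal.ofReal ((2 * (2 ^ i * (2 * δ))) ^ (d * i)) * volume U) ≠ ⊤ :=
    ENNReal.mul_ne_top (ENNReal.inv_ne_top.2 hV0)
      (ENNReal.mul_ne_top ENNReal.ofReal_ne_top hUv.ne)
  have hcard : i * (i + Fintype.card (Fin (n + 1))) = d * i := by
    rw [Fintype.card_fin, mul_comm]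
  rw [hcard] at hSv
  calc _ ≤ (V⁻¹ * (ENNReal.ofReal ((2 * (2 ^ i * (2 * δ))) ^ (d * i)) * volume U)).toReal := by
        refine ENNReal.toReal_mono hfin ?_
        gcongr
        exact hle.trans hSv
    _ = (V⁻¹ * volume U).toReal * (2 * (2 ^ i * 2)) ^ (d * i) * δ ^ (d * i) := by
        rw [mul_left_comm, ENNReal.toReal_mul, ENNReal.toReal_ofReal (by positivity),
          show 2 * (2 ^ i * (2 * δ)) = (2 * (2 ^ i * 2)) * δ by ring, mul_pow]
        ring
    _ ≤ _ := by
        refine mul_le_mul_of_nonneg_right ?_ (by positivity)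
        linarith

theorem exists_le_minimaDistribution {i n : ℕ} (hi : 1 ≤ i) :
    ∃ C > (0 : ℝ), ∃ δ₀ > (0 : ℝ), ∀ δ : ℝ, 0 < δ → δ < δ₀ →
      C * δ ^ ((i + (n + 1)) * i) ≤ minimaDistribution (i + (n + 1)) i δ := by
  set d := i + (n + 1) with hd
  have : Nonempty (Fin d) := ⟨⟨0, by omega⟩⟩
  have : Nonempty (Fin i) := ⟨⟨0, hi⟩⟩
  have hid : i ≤ d := by omega
  have hd0 : (0 : ℝ) < d := by exact_mod_cast (by omega : 0 < d)
  have hF := isLatticeFundamentalDomain_coneFundamentalDomain d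
  have hV0 := hF.volume_ne_zero
  have hVtop : volume (coneFundamentalDomain d) ≠ ⊤ := by
    obtain ⟨U, hUm, hUv, hU⟩ := exists_coversLattices_volume_lt_top (i + n)
    have h := hF.volume_inter_le (X := univ) hUm fun A hA => hU A hA.1.1
    rw [inter_univ] at h
    exact (h.trans_lt hUv).ne
  set V := volume (coneFundamentalDomain d)
  let e : Fin i ⊕ Fin (n + 1) ≃ Fin d := finSumFinEquiv
  obtain ⟨K, hK0, hKtop, η, hη, δ₁, hδ₁, hS⟩ :=
    exists_set_injective_mod_integral (m := Fin i) (0 : Fin (n + 1))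
  -- Rows of size `2 c δ` give successive minima at most `δ` after the determinant is normalized.
  set c : ℝ := (2 * d * η ^ (-(1 / d : ℝ)))⁻¹ with hc
  have hη' : 0 < η ^ (-(1 / d : ℝ)) := Real.rpow_pos_of_pos hη _
  have hc0 : 0 < c := by positivity
  refine ⟨(V⁻¹ * K).toReal * c ^ (d * i), ?_, δ₁ / c, by positivity, fun δ hδ hδlt => ?_⟩
  · refine mul_pos (ENNReal.toReal_pos (mul_ne_zero (ENNReal.inv_ne_zero.2 hVtop) hK0)
      (ENNReal.mul_ne_top (ENNReal.inv_ne_top.2 hV0) hKtop)) (by positivity)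
  obtain ⟨S, hSm, hSv, hSA, hinj⟩ := hS (c * δ) (by positivity)
    (by rwa [lt_div_iff₀ hc0, mul_comm] at hδlt)
  have he := measurePreserving_submatrix e.symm
  have hle := hF.le_volume_inter
    (X := {A | successiveMinimum i (columnLattice (unimodularTranspose A)) ≤ δ})
    (he.measurable hSm)
    (fun A hA => by
      have := (hSA _ hA).1
      rwa [Equiv.symm_symm, det_submatrix_equiv_self] at this)
    (fun A hA γ hγ => by
      obtain ⟨hA1, hA2, hA3⟩ := hSA _ hA
      rw [Equiv.symm_symm, det_submatrix_equiv_self] at hA1 hA2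
      rw [mem_ofPred_eq, unimodularTranspose_map_mul hA1.1 γ hγ,
        columnLattice_mul _ (transposeSLZ_mem γ hγ)]
      refine (successiveMinimum_le_of_rows_le hi hid hη hA2 (fun k => e (Sum.inl k))
        (e.injective.comp Sum.inl_injective) (b := 2 * (c * δ)) fun k l => ?_).trans_eq ?_
      · simpa using hA3 k (e.symm l)
      · rw [hc]
        field_simp)
    (fun A hA γ hγ => by
      rw [mem_preimage, ← submatrix_mul_equiv _ _ e.symm.symm e.symm.symm e.symm.symm,
        submatrix_map] at hγ
      have h1 := hinj _ hA _ hγ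
      have h2 := congrArg (fun M => M.submatrix e.symm e.symm) h1
      simpa using h2)
  rw [he.measure_preimage hSm.nullMeasurableSet, hSv] at hle
  rw [minimaDistribution_eq hi hid]
  have hfin : V⁻¹ * volume (coneFundamentalDomain d ∩
      {A | successiveMinimum i (columnLattice (unimodularTranspose A)) ≤ δ}) ≠ ⊤ :=
    ENNReal.mul_ne_top (ENNReal.inv_ne_top.2 hV0)
      (ne_top_of_le_ne_top hVtop (measure_mono inter_subset_left))
  have hcard : Fintype.card (Fin i) * Fintype.card (Fin i ⊕ Fin (n + 1)) = d * i := by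
    rw [Fintype.card_sum, Fintype.card_fin, Fintype.card_fin, mul_comm]
  rw [hcard] at hle
  calc (V⁻¹ * K).toReal * c ^ (d * i) * δ ^ (d * i) =
      (V⁻¹ * (ENNReal.ofReal ((c * δ) ^ (d * i)) * K)).toReal := by
        simp only [ENNReal.toReal_mul]
        rw [ENNReal.toReal_ofReal (by positivity), mul_pow]
        ring
    _ ≤ _ := by
        refine ENNReal.toReal_mono hfin ?_
        gcongr

theorem exists_bounds_minimaDistribution (d : ℕ) {i : ℕ} (hi : 1 ≤ i) (hid : i < d) :
    ∃ C > (0 : ℝ), ∃ C' > (0 : ℝ), ∃ δ₀ > (0 : ℝ), ∀ δ : ℝ, 0 < δ → δ < δ₀ →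
      C * δ ^ (d * i) ≤ minimaDistribution d i δ ∧ minimaDistribution d i δ ≤ C' * δ ^ (d * i) := by
  obtain ⟨n, rfl⟩ : ∃ n, d = i + (n + 1) := ⟨d - i - 1, by omega⟩
  obtain ⟨C, hC, δ₀, hδ₀, h⟩ := exists_le_minimaDistribution (n := n) hi
  obtain ⟨C', hC', h'⟩ := exists_minimaDistribution_le (n := n) hi
  exact ⟨C, hC, C', hC', δ₀, hδ₀, fun δ hδ hlt => ⟨h δ hδ hlt, h' δ hδ⟩⟩

theorem mainTheorem1 (d : ℕ) :
    ∃ C > (0 : ℝ), ∃ C' > (0 : ℝ), ∀ i : ℕ, 1 ≤ i → i < d →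
      ∃ ε : ℝ → ℝ, ε =o[𝓝[>] (0 : ℝ)] (fun δ : ℝ => δ ^ (d * i)) ∧
        ∃ δ₀ > (0 : ℝ), ∀ δ : ℝ, 0 < δ → δ < δ₀ →
          C * δ ^ (d * i) - ε δ ≤ minimaDistribution d i δ ∧
            minimaDistribution d i δ ≤ C' * δ ^ (d * i) := by
  choose! C hC C' hC' δ₀ hδ₀ h using fun i (hi : 1 ≤ i ∧ i < d) =>
    exists_bounds_minimaDistribution d hi.1 hi.2
  -- Uniform constants over the finitely many `i`.
  obtain ⟨c, hc, hcC⟩ : ∃ c > (0 : ℝ), ∀ i, 1 ≤ i ∧ i < d → c ≤ C i := by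
    have hsup : ∀ i ∈ (Finset.range d).filter (1 ≤ ·), 0 < C i := fun i hi => by
      simp only [Finset.mem_filter, Finset.mem_range] at hi
      exact hC i hi.symm
    rcases ((Finset.range d).filter (1 ≤ ·)).eq_empty_or_nonempty with he | hne
    · refine ⟨1, one_pos, fun i hi => ?_⟩
      have : i ∈ (Finset.range d).filter (1 ≤ ·) := by simp [hi]
      simp [he] at this
    · refine ⟨_, (Finset.lt_inf'_iff hne).2 hsup, fun i hi => Finset.inf'_le _ (by simp [hi])⟩
  refine ⟨c, hc, ∑ i ∈ Finset.range d, |C' i| + 1, by positivity, fun i hi hid =>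
    ⟨0, isLittleO_zero _ _, δ₀ i, hδ₀ i ⟨hi, hid⟩, fun δ hδ hlt => ?_⟩⟩
  obtain ⟨h1, h2⟩ := h i ⟨hi, hid⟩ δ hδ hlt
  have hpow : 0 ≤ δ ^ (d * i) := by positivity
  constructor
  · rw [Pi.zero_apply, sub_zero]
    exact (mul_le_mul_of_nonneg_right (hcC i ⟨hi, hid⟩) hpow).trans h1
  · refine h2.trans (mul_le_mul_of_nonneg_right ?_ hpow)
    have := Finset.single_le_sum (f := fun i => |C' i|) (fun _ _ => abs_nonneg _)
      (Finset.mem_range.2 hid)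
    have h3 := le_abs_self (C' i)
    linarith
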